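/- Let $M$ be a compact smooth manifold with a bi-Hermitian structure $(g,I_+,I_-)$, that is, a Riemannian metric $g$ and two integrable complex structures $I_\pm$, both orthogonal with respect to $g$; put $\omega_\pm(\cdot,\cdot)=g(I_\pm\cdot,\cdot)$ and let $\Lambda_\pm$ be the contraction of $2$-forms with $\omega_\pm$, $\Lambda_\pm\beta=\tfrac12\sum_j\beta(e_j,I_\pm e_j)$ for any local $g$-orthonormal frame $(e_j)$. Let $V$ be a complex vector bundle of finite rank on $M$ with holomorphic structures $\bar\partial_+$ and $\bar\partial_-$ with respect to $I_+$ and $I_-$, respectively, and let $h$ be a Hermitian metric on $V$. Denote by $\nabla^C_\pm$ the Chern connections of $(\bar\partial_\pm,h)$ (the $h$-unitary connections whose $(0,1)$-parts with respect to $I_\pm$ are $\bar\partial_\pm$) and by $F_\pm$ their curvatures. Let $\alpha\in[0,1]$ and $\lambda\in\mathbb{R}$, and suppose that $h$ is $\alpha$-Hermitian-Einstein with constant $\lambda$, that is, $$\alpha\,\sqrt{-1}\,\Lambda_+F_+ +(1-\alpha)\,\sqrt{-1}\,\Lambda_-F_-=\lambda\,\mathrm{Id}_V .$$ A global smooth section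 $s$ of $V$ is called $I_\pm$-holomorphic if $\bar\partial_+s=0$ and $\bar\partial_-s=0$. 1. If $\lambda<0$, then $V$ has no nonzero global $I_\pm$-holomorphic section. 2. If $\lambda=0$ and $\alpha\in(0,1)$, then every global $I_\pm$-holomorphic section $s$ of $V$ is parallel for both Chern connections: $\nabla^C_+s=0$ and $\nabla^C_-s=0$. -/

import Mathlib

open Bundle
open scoped Manifold ContDiff

set_option linter.unusedSectionVars false

set_option linter.unusedSimpArgs false

noncomputable section

namespace BiHerm

section Base

variable (E : Type*) [NormedAddCommGroup E] [NormedSpace ℝ E]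
  (M : Type*) [TopologicalSpace M] [ChartedSpace E M] [IsManifold 𝓘(ℝ, E) ∞ M]

/-- A smooth vector field on `M`. -/
def IsSmoothVF {E : Type*} [NormedAddCommGroup E] [NormedSpace ℝ E]
    {M : Type*} [TopologicalSpace M] [ChartedSpace E M] [IsManifold 𝓘(ℝ, E) ∞ M]
    (X : ∀ x : M, TangentSpace 𝓘(ℝ, E) x) : Prop :=
  ContMDiff 𝓘(ℝ, E) (𝓘(ℝ, E).prod 𝓘(ℝ, E)) ∞
    (fun x => TotalSpace.mk' E (E := fun y : M => TangentSpace 𝓘(ℝ, E) y) x (X x))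

/-- An integrable complex structure on the smooth manifold `M`: a smooth endomorphism `J` of the
tangent bundle with `J² = -1` and with vanishing Nijenhuis tensor. -/
structure ComplexStructure where
  /-- the endomorphism of each tangent space -/
  J : ∀ x : M, TangentSpace 𝓘(ℝ, E) x →L[ℝ] TangentSpace 𝓘(ℝ, E) x
  sq_eq_neg : ∀ (x : M) (v : TangentSpace 𝓘(ℝ, E) x), J x (J x v) = -v
  contMDiff : ContMDiff 𝓘(ℝ, E) (𝓘(ℝ, E).prod 𝓘(ℝ, E →L[ℝ] E)) ∞
    (fun x => TotalSpace.mk' (E →L[ℝ] E)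
      (E := fun y : M => TangentSpace 𝓘(ℝ, E) y →L[ℝ] TangentSpace 𝓘(ℝ, E) y) x (J x))
  integrable : ∀ X Y : (∀ x : M, TangentSpace 𝓘(ℝ, E) x), IsSmoothVF X → IsSmoothVF Y →
    ∀ x : M,
      VectorField.mlieBracket 𝓘(ℝ, E) (fun y => J y (X y)) (fun y => J y (Y y)) x
        - J x (VectorField.mlieBracket 𝓘(ℝ, E) (fun y => J y (X y)) Y x)
        - J x (VectorField.mlieBracket 𝓘(ℝ, E) X (fun y => J y (Y y)) x)
        - VectorField.mlieBracket 𝓘(ℝ, E) X Y x = 0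

/-- A bi-Hermitian structure `(g, I₊, I₋)` on `M`: a Riemannian metric and two integrable complex
structures, both orthogonal with respect to the metric. -/
structure BiHermitianStructure where
  /-- the Riemannian metric -/
  g : ContMDiffRiemannianMetric 𝓘(ℝ, E) ∞ E (fun x : M => TangentSpace 𝓘(ℝ, E) x)
  /-- the complex structure `I₊` -/
  Ip : ComplexStructure E M
  /-- the complex structure `I₋` -/
  Im : ComplexStructure E M
  orthogonal_p : ∀ (x : M) (u v : TangentSpace 𝓘(ℝ, E) x),
    g.inner x (Ip.J x u) (Ip.J x v) = g.inner x u v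
  orthogonal_m : ∀ (x : M) (u v : TangentSpace 𝓘(ℝ, E) x),
    g.inner x (Im.J x u) (Im.J x v) = g.inner x u v

variable {E M}

/-- The `(1,0)`-part of the differential of a complex function `f`, evaluated on real tangent
vectors: `∂f(v) = (df(v) - i df(Jv)) / 2`. -/
def del (J : ComplexStructure E M) (f : M → ℂ) (x : M) : TangentSpace 𝓘(ℝ, E) x →L[ℝ] ℂ :=
  (1 / 2 : ℂ) • (mvfderiv 𝓘(ℝ, E) f x - Complex.I • (mvfderiv 𝓘(ℝ, E) f x ∘L J.J x))

/-- The `(0,1)`-part of the differential of a complex function `f`, evaluated on real tangent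
vectors: `∂̄f(v) = (df(v) + i df(Jv)) / 2`. -/
def delbar (J : ComplexStructure E M) (f : M → ℂ) (x : M) : TangentSpace 𝓘(ℝ, E) x →L[ℝ] ℂ :=
  (1 / 2 : ℂ) • (mvfderiv 𝓘(ℝ, E) f x + Complex.I • (mvfderiv 𝓘(ℝ, E) f x ∘L J.J x))

end Base

section Bundles

variable {E : Type*} [NormedAddCommGroup E] [NormedSpace ℝ E]
  {M : Type*} [TopologicalSpace M] [ChartedSpace E M] [IsManifold 𝓘(ℝ, E) ∞ M]
  (F : Type*) [NormedAddCommGroup F] [NormedSpace ℂ F]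
  (V : M → Type*) [TopologicalSpace (TotalSpace F V)]
  [∀ x, AddCommGroup (V x)] [∀ x, Module ℂ (V x)] [∀ x, TopologicalSpace (V x)]
  [∀ x, IsTopologicalAddGroup (V x)] [∀ x, ContinuousSMul ℝ (V x)]
  [FiberBundle F V] [VectorBundle ℝ F V]

variable (E) in
/-- The section `σ` of `V` is differentiable at `x` (in the sense of real manifolds). -/
def DiffAt {V : M → Type*} [TopologicalSpace (TotalSpace F V)]
    [∀ x, TopologicalSpace (V x)] [FiberBundle F V] (σ : ∀ x, V x) (x : M) : Prop :=
  MDifferentiableAt 𝓘(ℝ, E) (𝓘(ℝ, E).prod 𝓘(ℝ, F)) (fun y => TotalSpace.mk' F y (σ y)) x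

variable (E) in
/-- The section `σ` of `V` is smooth (in the sense of real manifolds). -/
def IsSmoothSection {V : M → Type*} [TopologicalSpace (TotalSpace F V)]
    [∀ x, TopologicalSpace (V x)] [FiberBundle F V] (σ : ∀ x, V x) : Prop :=
  ContMDiff 𝓘(ℝ, E) (𝓘(ℝ, E).prod 𝓘(ℝ, F)) ∞ (fun y => TotalSpace.mk' F y (σ y))

/-- A holomorphic structure `∂̄ : C^∞(V) → C^∞(V ⊗ T^{0,1}M)` on the complex vector bundle `V` with
respect to the complex structure `J`. A `V`-valued `(0,1)`-form is recorded by its values on real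
tangent vectors `v`, which are its values on the `(0,1)`-parts `v^{0,1} = (v + i J v) / 2`; it is of
type `(0,1)` iff it anticommutes with `i`. As for Mathlib's `CovariantDerivative`, the operator is
a function on arbitrary sections, but its values matter only where the section is
differentiable. -/
structure HolomorphicStructure (J : ComplexStructure E M) where
  /-- `toFun σ x v` is the value at `x` of `∂̄σ` on `v`. -/
  toFun : (∀ x, V x) → ∀ x : M, TangentSpace 𝓘(ℝ, E) x →L[ℝ] V x
  add : ∀ (σ τ : ∀ x, V x) (x : M), DiffAt E F σ x → DiffAt E F τ x →
    toFun (fun y => σ y + τ y) x = toFun σ x + toFun τ x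
  leibniz : ∀ (f : M → ℂ) (σ : ∀ x, V x) (x : M),
    MDifferentiableAt 𝓘(ℝ, E) 𝓘(ℝ, ℂ) f x → DiffAt E F σ x → ∀ v,
    toFun (fun y => f y • σ y) x v = delbar J f x v • σ x + f x • toFun σ x v
  /-- `∂̄σ` is of type `(0,1)` -/
  type01 : ∀ (σ : ∀ x, V x) (x : M) (v : TangentSpace 𝓘(ℝ, E) x), DiffAt E F σ x →
    toFun σ x (J.J x v) = -(Complex.I • toFun σ x v)
  /-- `∂̄` maps smooth sections to smooth forms -/
  smooth : ∀ σ : (∀ x, V x), IsSmoothSection E F σ →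
    ContMDiff 𝓘(ℝ, E) (𝓘(ℝ, E).prod 𝓘(ℝ, E →L[ℝ] F)) ∞
      (fun x => TotalSpace.mk' (E →L[ℝ] F)
        (E := fun y : M => TangentSpace 𝓘(ℝ, E) y →L[ℝ] V y) x (toFun σ x))
  /-- `∂̄² = 0`, that is `∂̄_Z ∂̄_W σ - ∂̄_W ∂̄_Z σ = ∂̄_{[Z, W]} σ` for `Z = X^{0,1}`, `W = Y^{0,1}`,
  where `[Z, W] = ([X, Y] - [JX, JY] + i ([JX, Y] + [X, JY])) / 4`. -/
  flat : ∀ (X Y : ∀ x : M, TangentSpace 𝓘(ℝ, E) x) (σ : ∀ x, V x),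
    IsSmoothVF X → IsSmoothVF Y → IsSmoothSection E F σ → ∀ x : M,
    toFun (fun y => toFun σ y (Y y)) x (X x) - toFun (fun y => toFun σ y (X y)) x (Y x)
      = (1 / 4 : ℂ) •
        (toFun σ x (VectorField.mlieBracket 𝓘(ℝ, E) X Y x
            - VectorField.mlieBracket 𝓘(ℝ, E) (fun y => J.J y (X y)) (fun y => J.J y (Y y)) x)
          + Complex.I • toFun σ x (VectorField.mlieBracket 𝓘(ℝ, E) (fun y => J.J y (X y)) Y x
            + VectorField.mlieBracket 𝓘(ℝ, E) X (fun y => J.J y (Y y)) x))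

/-- A smooth Hermitian metric on the complex vector bundle `V`, complex linear in the first
variable and conjugate linear in the second. -/
structure HermitianMetric where
  /-- the Hermitian inner product on each fibre -/
  inner : ∀ x : M, V x →L[ℝ] V x →L[ℝ] ℂ
  smul_left : ∀ (x : M) (c : ℂ) (v w : V x), inner x (c • v) w = c * inner x v w
  conj_symm : ∀ (x : M) (v w : V x), inner x w v = (starRingEnd ℂ) (inner x v w)
  pos : ∀ (x : M) (v : V x), v ≠ 0 → 0 < (inner x v v).re
  contMDiff : ContMDiff 𝓘(ℝ, E) (𝓘(ℝ, E).prod 𝓘(ℝ, F →L[ℝ] F →L[ℝ] ℂ)) ∞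
    (fun x => TotalSpace.mk' (F →L[ℝ] F →L[ℝ] ℂ)
      (E := fun y : M => V y →L[ℝ] V y →L[ℝ] ℂ) x (inner x))

section Chern

variable {F V}
variable {J : ComplexStructure E M} (D : HolomorphicStructure F V J)
  (h : HermitianMetric (E := E) F V)

/-- The `1`-form `v ↦ ∂(h(σ, τ))(v) - h(σ, ∂̄_v τ)`; it is the form `h(∂σ, τ)` for the `(1,0)`-part
`∂` of the Chern connection. -/
def chernForm (σ τ : ∀ x, V x) (x : M) : TangentSpace 𝓘(ℝ, E) x →L[ℝ] ℂ :=
  del J (fun y => h.inner y (σ y) (τ y)) x - h.inner x (σ x) ∘L D.toFun τ x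

theorem HermitianMetric.mdifferentiableAt [ContMDiffVectorBundle ∞ F V 𝓘(ℝ, E)]
    {σ τ : ∀ x, V x} {x : M} (hσ : DiffAt E F σ x) (hτ : DiffAt E F τ x) :
    MDifferentiableAt 𝓘(ℝ, E) 𝓘(ℝ, ℂ) (fun y => h.inner y (σ y) (τ y)) x := by
  have h1 := (h.contMDiff x).mdifferentiableAt (by simp)
  have := MDifferentiableAt.clm_bundle_apply₂ (𝕜 := ℝ) (F₁ := F) (F₂ := F) (F₃ := ℂ)
    (E₃ := fun _ : M => ℂ) (IB := 𝓘(ℝ, E)) (IM := 𝓘(ℝ, E)) (b := fun y : M => y) h1 hσ hτ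
  simp only [mdifferentiableAt_section] at this
  exact this

theorem HermitianMetric.smul_right (x : M) (c : ℂ) (v w : V x) :
    h.inner x v (c • w) = (starRingEnd ℂ) c * h.inner x v w := by
  rw [h.conj_symm, h.smul_left, map_mul, ← h.conj_symm]

theorem mvfderiv_ofReal {f : M → ℝ} {x : M} (hf : MDifferentiableAt 𝓘(ℝ, E) 𝓘(ℝ, ℝ) f x)
    (v : TangentSpace 𝓘(ℝ, E) x) :
    mvfderiv 𝓘(ℝ, E) (fun y => (f y : ℂ)) x v = (mvfderiv 𝓘(ℝ, E) f x v : ℂ) := by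
  have e : (fun y => (f y : ℂ)) = f • (fun _ : M => (1 : ℂ)) := by
    ext y; simp
  rw [e, mvfderiv_smul hf mdifferentiableAt_const]
  simp [mvfderiv_const]

theorem del_smul {f : M → ℝ} {u : M → ℂ} {x : M}
    (hf : MDifferentiableAt 𝓘(ℝ, E) 𝓘(ℝ, ℝ) f x)
    (hu : MDifferentiableAt 𝓘(ℝ, E) 𝓘(ℝ, ℂ) u x) (v : TangentSpace 𝓘(ℝ, E) x) :
    del J (fun y => (f y : ℂ) * u y) x v
      = f x * del J u x v + del J (fun y => (f y : ℂ)) x v * u x := by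
  have e : (fun y => (f y : ℂ) * u y) = f • u := by
    ext y; simp
  simp only [e, del, mvfderiv_smul hf hu, smul_apply,
    sub_apply, add_apply, ContinuousLinearMap.comp_apply,
    ContinuousLinearMap.smulRight_apply, mvfderiv_ofReal hf, smul_eq_mul, Complex.real_smul]
  ring

theorem del_add {u w : M → ℂ} {x : M}
    (hu : MDifferentiableAt 𝓘(ℝ, E) 𝓘(ℝ, ℂ) u x)
    (hw : MDifferentiableAt 𝓘(ℝ, E) 𝓘(ℝ, ℂ) w x) (v : TangentSpace 𝓘(ℝ, E) x) :
    del J (fun y => u y + w y) x v = del J u x v + del J w x v := by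
  simp only [del, mvfderiv_fun_add hu hw, smul_apply,
    sub_apply, add_apply, ContinuousLinearMap.comp_apply,
    smul_eq_mul]
  ring

theorem conj_delbar_ofReal {f : M → ℝ} {x : M}
    (hf : MDifferentiableAt 𝓘(ℝ, E) 𝓘(ℝ, ℝ) f x) (v : TangentSpace 𝓘(ℝ, E) x) :
    (starRingEnd ℂ) (delbar J (fun y => (f y : ℂ)) x v) = del J (fun y => (f y : ℂ)) x v := by
  simp only [del, delbar, smul_apply, sub_apply,
    add_apply, ContinuousLinearMap.comp_apply, mvfderiv_ofReal hf,
    smul_eq_mul, map_mul, map_add, map_div₀, map_one, map_ofNat, Complex.conj_ofReal,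
    Complex.conj_I]
  ring

theorem del_add_delbar_ofReal {f : M → ℝ} {x : M}
    (hf : MDifferentiableAt 𝓘(ℝ, E) 𝓘(ℝ, ℝ) f x) (v : TangentSpace 𝓘(ℝ, E) x) :
    del J (fun y => (f y : ℂ)) x v + delbar J (fun y => (f y : ℂ)) x v
      = (mvfderiv 𝓘(ℝ, E) f x v : ℂ) := by
  simp only [del, delbar, smul_apply, sub_apply,
    add_apply, ContinuousLinearMap.comp_apply, mvfderiv_ofReal hf,
    smul_eq_mul]
  ring

theorem mdifferentiableAt_ofReal {f : M → ℝ} {x : M}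
    (hf : MDifferentiableAt 𝓘(ℝ, E) 𝓘(ℝ, ℝ) f x) :
    MDifferentiableAt 𝓘(ℝ, E) 𝓘(ℝ, ℂ) (fun y => (f y : ℂ)) x := by
  have e : (fun y => (f y : ℂ)) = f • (fun _ : M => (1 : ℂ)) := by
    ext y; simp
  rw [e]
  exact hf.smul mdifferentiableAt_const

theorem leibniz_real {f : M → ℝ} {σ : ∀ x, V x} {x : M}
    (hf : MDifferentiableAt 𝓘(ℝ, E) 𝓘(ℝ, ℝ) f x) (hσ : DiffAt E F σ x)
    (v : TangentSpace 𝓘(ℝ, E) x) :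
    D.toFun (f • σ) x v
      = delbar J (fun y => (f y : ℂ)) x v • σ x + (f x : ℂ) • D.toFun σ x v := by
  have := D.leibniz (fun y => (f y : ℂ)) σ x (mdifferentiableAt_ofReal hf) hσ v
  rw [← this]
  rfl

variable [ContMDiffVectorBundle ∞ F V 𝓘(ℝ, E)]

theorem chernForm_tensorial {σ : ∀ x, V x} {x : M} (hσ : DiffAt E F σ x) :
    TensorialAt 𝓘(ℝ, E) F (fun τ => chernForm D h σ τ x) x where
  smul {f τ} hf hτ := by
    ext v
    have e : (fun y => h.inner y (σ y) ((f • τ) y)) = fun y => (f y : ℂ) * h.inner y (σ y) (τ y) := by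
      ext y
      exact (map_smul (h.inner y (σ y)) (f y) (τ y)).trans (Complex.real_smul)
    simp only [chernForm, sub_apply, ContinuousLinearMap.comp_apply,
      smul_apply]
    rw [e, del_smul hf (h.mdifferentiableAt hσ hτ), leibniz_real D hf hτ, map_add,
      h.smul_right, h.smul_right, conj_delbar_ofReal hf, Complex.conj_ofReal, Complex.real_smul]
    ring
  add {τ τ'} hτ hτ' := by
    ext v
    simp only [chernForm, sub_apply, ContinuousLinearMap.comp_apply,
      add_apply, Pi.add_apply, map_add]
    rw [del_add (h.mdifferentiableAt hσ hτ) (h.mdifferentiableAt hσ hτ')]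
    have := D.add τ τ' x hτ hτ'
    rw [show (τ + τ') = fun y => τ y + τ' y from rfl, this]
    simp only [add_apply, map_add]
    ring

variable [FiniteDimensional ℂ F]

/-- The Riesz isomorphism of the real inner product `Re h` on the fibre at `x`. -/
def HermitianMetric.riesz (x : M) : V x ≃ₗ[ℝ] (V x →ₗ[ℝ] ℝ) :=
  have : FiniteDimensional ℝ (V x) := VectorBundle.finiteDimensional ℝ F V x
  LinearEquiv.ofInjectiveOfFinrankEq
    ({ toFun := fun v => Complex.reLm ∘ₗ (h.inner x v).toLinearMap
       map_add' := fun v w => by ext u; simp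
       map_smul' := fun c v => by ext u; simp } : V x →ₗ[ℝ] (V x →ₗ[ℝ] ℝ))
    (by
      rw [← LinearMap.ker_eq_bot, LinearMap.ker_eq_bot']
      intro v hv
      by_contra hne
      have h1 := h.pos x v hne
      have h2 := LinearMap.congr_fun hv v
      simp at h2
      linarith)
    (by rw [Subspace.dual_finrank_eq])

theorem HermitianMetric.riesz_apply (x : M) (v w : V x) :
    h.riesz x v w = (h.inner x v w).re := rfl

theorem HermitianMetric.re_ext {x : M} {v w : V x}
    (hvw : ∀ u, (h.inner x v u).re = (h.inner x w u).re) : v = w := by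
  apply (h.riesz x).injective
  ext u
  simpa only [h.riesz_apply] using hvw u

/-- For `σ` differentiable at `x`, the functional
`w = τ(x) ↦ Re (∂(h(σ, τ))(v) - h(σ, ∂̄_v τ))` on the fibre at `x`, as a function of `v`. -/
def chernFunctional {σ : ∀ x, V x} {x : M} (hσ : DiffAt E F σ x) :
    TangentSpace 𝓘(ℝ, E) x →ₗ[ℝ] (V x →ₗ[ℝ] ℝ) where
  toFun v :=
    { toFun := fun w => (TensorialAt.mkHom (fun τ => chernForm D h σ τ x) x
        (chernForm_tensorial D h hσ) w v).re
      map_add' := fun w w' => by simp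
      map_smul' := fun c w => by simp }
  map_add' v v' := by ext w; simp
  map_smul' c v := by ext w; simp

variable [FiniteDimensional ℝ E]

/-- The `(1,0)`-part `∂` of the Chern connection: `∂_v σ` is the vector of the fibre that represents
the functional `τ ↦ ∂(h(σ, τ))(v) - h(σ, ∂̄_v τ)` through the metric `h`. It is set to `0` at points
where `σ` is not differentiable. -/
def chernDel (σ : ∀ x, V x) (x : M) : TangentSpace 𝓘(ℝ, E) x →L[ℝ] V x :=
  open Classical in
  if hσ : DiffAt E F σ x then
    have : FiniteDimensional ℝ (TangentSpace 𝓘(ℝ, E) x) := inferInstanceAs (FiniteDimensional ℝ E)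
    have : T2Space (TangentSpace 𝓘(ℝ, E) x) := inferInstanceAs (T2Space E)
    LinearMap.toContinuousLinearMap
      ((h.riesz x).symm.toLinearMap ∘ₗ chernFunctional D h hσ)
  else 0

theorem re_inner_chernDel {σ τ : ∀ x, V x} {x : M} (hσ : DiffAt E F σ x) (hτ : DiffAt E F τ x)
    (v : TangentSpace 𝓘(ℝ, E) x) :
    (h.inner x (chernDel D h σ x v) (τ x)).re = (chernForm D h σ τ x v).re := by
  have e : chernDel D h σ x v = (h.riesz x).symm (chernFunctional D h hσ v) := by
    simp only [chernDel, dif_pos hσ]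
    rfl
  rw [e, ← h.riesz_apply, LinearEquiv.apply_symm_apply]
  change (TensorialAt.mkHom (fun τ => chernForm D h σ τ x) x
        (chernForm_tensorial D h hσ) (τ x) v).re = _
  rw [TensorialAt.mkHom_apply _ hτ]

theorem diffAt_extend {x : M} (w : V x) : DiffAt E F (FiberBundle.extend F w) x :=
  FiberBundle.mdifferentiableAt_extend ..

theorem diffAt_add {σ τ : ∀ x, V x} {x : M} (hσ : DiffAt E F σ x) (hτ : DiffAt E F τ x) :
    DiffAt E F (σ + τ) x :=
  mdifferentiableAt_add_section hσ hτ

theorem diffAt_smul {f : M → ℝ} {σ : ∀ x, V x} {x : M}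
    (hf : MDifferentiableAt 𝓘(ℝ, E) 𝓘(ℝ, ℝ) f x) (hσ : DiffAt E F σ x) :
    DiffAt E F (f • σ) x :=
  hf.smul_section hσ

/-- The Chern connection `∇ = ∂ + ∂̄` of the Hermitian metric `h` and the holomorphic structure
`∂̄`. -/
def chernConnection : CovariantDerivative 𝓘(ℝ, E) F V where
  toFun σ x := chernDel D h σ x + D.toFun σ x
  isCovariantDerivativeOnUniv :=
    { add := by
        intro σ σ' x hσ hσ' _
        have h1 : D.toFun (σ + σ') x = D.toFun σ x + D.toFun σ' x := D.add σ σ' x hσ hσ'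
        have h2 : chernDel D h (σ + σ') x = chernDel D h σ x + chernDel D h σ' x := by
          ext v
          apply h.re_ext
          intro u
          have hu := diffAt_extend (E := E) (F := F) u
          rw [← FiberBundle.extend_apply_self (F := F) u,
            re_inner_chernDel D h (diffAt_add hσ hσ') hu]
          simp only [add_apply, map_add, Complex.add_re, re_inner_chernDel D h hσ hu,
            re_inner_chernDel D h hσ' hu]
          rw [← Complex.add_re]
          congr 1
          simp only [chernForm, sub_apply, ContinuousLinearMap.comp_apply, Pi.add_apply, map_add,
            add_apply]
          rw [del_add (h.mdifferentiableAt hσ hu) (h.mdifferentiableAt hσ' hu)]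
          ring
        rw [h1, h2]
        abel
      leibniz := by
        intro σ f x hσ hf _
        ext v
        have h1 := leibniz_real D hf hσ v
        have h2 : chernDel D h (f • σ) x v
            = del J (fun y => (f y : ℂ)) x v • σ x + (f x : ℂ) • chernDel D h σ x v := by
          apply h.re_ext
          intro u
          have hu := diffAt_extend (E := E) (F := F) u
          rw [← FiberBundle.extend_apply_self (F := F) u,
            re_inner_chernDel D h (diffAt_smul hf hσ) hu]
          simp only [map_add, add_apply, h.smul_left, Complex.add_re, Complex.re_ofReal_mul,
            re_inner_chernDel D h hσ hu]
          rw [← Complex.re_ofReal_mul, ← Complex.add_re]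
          congr 1
          have e : (fun y => h.inner y ((f • σ) y) (FiberBundle.extend F u y))
              = fun y => (f y : ℂ) * h.inner y (σ y) (FiberBundle.extend F u y) := by
            ext y
            rw [Pi.smul_apply', ← Complex.coe_smul, h.smul_left]
          simp only [chernForm, sub_apply, ContinuousLinearMap.comp_apply, e]
          rw [del_smul hf (h.mdifferentiableAt hσ hu), Pi.smul_apply', ← Complex.coe_smul,
            h.smul_left]
          ring
        simp only [add_apply, h1, h2, smul_apply, ContinuousLinearMap.smulRight_apply]
        rw [← Complex.coe_smul (mvfderiv 𝓘(ℝ, E) f x v), ← del_add_delbar_ofReal (J := J) hf v,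
          ← Complex.coe_smul (f x)]
        module }

section Properties

variable [VectorBundle ℂ F V]

theorem diffAt_const_smul (c : ℂ) {σ : ∀ x, V x} {x : M} (hσ : DiffAt E F σ x) :
    DiffAt E F (fun y => c • σ y) x := by
  unfold DiffAt at *
  rw [mdifferentiableAt_section] at *
  have h1 := (((c • ContinuousLinearMap.id ℂ F).restrictScalars ℝ).mdifferentiableAt
    (x := (trivializationAt F V x ⟨x, σ x⟩).2)).comp x hσ
  refine h1.congr_of_eventuallyEq ?_
  filter_upwards [(trivializationAt F V x).open_baseSet.mem_nhds
    (FiberBundle.mem_baseSet_trivializationAt F V x)] with y hy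
  exact ((trivializationAt F V x).linear ℂ hy).map_smul c (σ y)

theorem mvfderiv_clm (L : ℂ →L[ℝ] ℂ) {u : M → ℂ} {x : M}
    (hu : MDifferentiableAt 𝓘(ℝ, E) 𝓘(ℝ, ℂ) u x) (v : TangentSpace 𝓘(ℝ, E) x) :
    mvfderiv 𝓘(ℝ, E) (fun y => L (u y)) x v = L (mvfderiv 𝓘(ℝ, E) u x v) := by
  have := mfderiv_comp x (I := 𝓘(ℝ, E)) (I' := 𝓘(ℝ, ℂ)) (I'' := 𝓘(ℝ, ℂ)) L.mdifferentiableAt hu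
  simp only [mvfderiv]
  rw [show (fun y => L (u y)) = L ∘ u from rfl, this, ContinuousLinearMap.mfderiv_eq]
  rfl

theorem mvfderiv_conj {u : M → ℂ} {x : M}
    (hu : MDifferentiableAt 𝓘(ℝ, E) 𝓘(ℝ, ℂ) u x) (v : TangentSpace 𝓘(ℝ, E) x) :
    mvfderiv 𝓘(ℝ, E) (fun y => (starRingEnd ℂ) (u y)) x v
      = (starRingEnd ℂ) (mvfderiv 𝓘(ℝ, E) u x v) :=
  mvfderiv_clm Complex.conjCLE.toContinuousLinearMap hu v

theorem mvfderiv_const_mul (c : ℂ) {u : M → ℂ} {x : M}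
    (hu : MDifferentiableAt 𝓘(ℝ, E) 𝓘(ℝ, ℂ) u x) (v : TangentSpace 𝓘(ℝ, E) x) :
    mvfderiv 𝓘(ℝ, E) (fun y => c * u y) x v = c * mvfderiv 𝓘(ℝ, E) u x v :=
  mvfderiv_clm ((c • ContinuousLinearMap.id ℂ ℂ).restrictScalars ℝ) hu v

theorem chernForm_I_smul {σ τ : ∀ x, V x} {x : M} (hσ : DiffAt E F σ x) (hτ : DiffAt E F τ x)
    (v : TangentSpace 𝓘(ℝ, E) x) :
    chernForm D h σ (fun y => Complex.I • τ y) x v = -Complex.I * chernForm D h σ τ x v := by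
  have e : (fun y => h.inner y (σ y) (Complex.I • τ y))
      = fun y => -Complex.I * h.inner y (σ y) (τ y) := by
    ext y
    rw [h.smul_right, Complex.conj_I]
  have h1 := D.leibniz (fun _ => Complex.I) τ x mdifferentiableAt_const hτ v
  have h0 : delbar J (fun _ : M => Complex.I) x v = 0 := by
    simp [delbar, mvfderiv_const]
  rw [h0, zero_smul, zero_add] at h1
  have hu := h.mdifferentiableAt hσ hτ
  simp only [chernForm, sub_apply, ContinuousLinearMap.comp_apply, e, h1, h.smul_right,
    Complex.conj_I, del, smul_apply, smul_eq_mul, mvfderiv_const_mul _ hu]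
  ring

/-- The characterization of the `(1,0)`-part of the Chern connection:
`∂(h(σ, τ)) = h(∂σ, τ) + h(σ, ∂̄τ)`. -/
theorem del_inner {σ τ : ∀ x, V x} {x : M} (hσ : DiffAt E F σ x) (hτ : DiffAt E F τ x)
    (v : TangentSpace 𝓘(ℝ, E) x) :
    del J (fun y => h.inner y (σ y) (τ y)) x v
      = h.inner x (chernDel D h σ x v) (τ x) + h.inner x (σ x) (D.toFun τ x v) := by
  have key : h.inner x (chernDel D h σ x v) (τ x) = chernForm D h σ τ x v := by
    apply Complex.ext (re_inner_chernDel D h hσ hτ v)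
    have := re_inner_chernDel D h hσ (diffAt_const_smul Complex.I hτ) v
    rw [chernForm_I_smul D h hσ hτ, h.smul_right] at this
    simpa using this
  rw [key]
  simp [chernForm]

/-- `∂σ` is of type `(1,0)`, so that `∂̄` is the `(0,1)`-part of the Chern connection. -/
theorem chernDel_J {σ : ∀ x, V x} {x : M} (hσ : DiffAt E F σ x)
    (v : TangentSpace 𝓘(ℝ, E) x) :
    chernDel D h σ x (J.J x v) = Complex.I • chernDel D h σ x v := by
  apply h.re_ext
  intro u
  have hu := diffAt_extend (E := E) (F := F) u
  have h1 := del_inner D h hσ hu v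
  have h2 := del_inner D h hσ hu (J.J x v)
  have h3 : del J (fun y => h.inner y (σ y) (FiberBundle.extend F u y)) x (J.J x v)
      = Complex.I * del J (fun y => h.inner y (σ y) (FiberBundle.extend F u y)) x v := by
    simp only [del, smul_apply, sub_apply, ContinuousLinearMap.comp_apply, J.sq_eq_neg, map_neg,
      smul_eq_mul]
    linear_combination (1 / 2 * mvfderiv 𝓘(ℝ, E)
      (fun y => h.inner y (σ y) (FiberBundle.extend F u y)) x (J.J x v)) * Complex.I_mul_I
  rw [D.type01 _ x v hu, map_neg, h.smul_right, Complex.conj_I, h3, h1,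
    FiberBundle.extend_apply_self] at h2
  rw [h.smul_left]
  congr 1
  linear_combination -h2

/-- The Chern connection is unitary. -/
theorem chernConnection_unitary {σ τ : ∀ x, V x} {x : M}
    (hσ : DiffAt E F σ x) (hτ : DiffAt E F τ x) (v : TangentSpace 𝓘(ℝ, E) x) :
    mvfderiv 𝓘(ℝ, E) (fun y => h.inner y (σ y) (τ y)) x v
      = h.inner x (chernConnection D h σ x v) (τ x)
        + h.inner x (σ x) (chernConnection D h τ x v) := by
  have h1 := del_inner D h hσ hτ v
  have h2 := congrArg (starRingEnd ℂ) (del_inner D h hτ hσ v)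
  have e : (fun y => h.inner y (τ y) (σ y))
      = fun y => (starRingEnd ℂ) (h.inner y (σ y) (τ y)) := by
    ext y
    exact h.conj_symm _ _ _
  have hu := h.mdifferentiableAt hσ hτ
  rw [map_add, ← h.conj_symm, ← h.conj_symm, e] at h2
  have h3 : mvfderiv 𝓘(ℝ, E) (fun y => h.inner y (σ y) (τ y)) x v
      = del J (fun y => h.inner y (σ y) (τ y)) x v
        + (starRingEnd ℂ) (del J (fun y => (starRingEnd ℂ) (h.inner y (σ y) (τ y))) x v) := by
    simp only [del, smul_apply, sub_apply, ContinuousLinearMap.comp_apply, smul_eq_mul,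
      mvfderiv_conj hu, map_mul, map_sub, map_div₀, map_one, map_ofNat, Complex.conj_conj,
      Complex.conj_I]
    ring
  rw [h3, h1, h2]
  change _ = h.inner x (chernDel D h σ x v + D.toFun σ x v) (τ x)
    + h.inner x (σ x) (chernDel D h τ x v + D.toFun τ x v)
  simp only [map_add, add_apply]
  ring

end Properties

end Chern

section HermitianEinstein

variable {F V}

/-- The curvature of a connection on `V`, as an operator on vector fields and sections:
`F(X, Y)σ = ∇_X ∇_Y σ - ∇_Y ∇_X σ - ∇_{[X, Y]} σ`. -/
def curvature (D : CovariantDerivative 𝓘(ℝ, E) F V)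
    (X Y : ∀ x : M, TangentSpace 𝓘(ℝ, E) x) (σ : ∀ x, V x) (x : M) : V x :=
  D (fun y => D σ y (Y y)) x (X x) - D (fun y => D σ y (X y)) x (Y x)
    - D σ x (VectorField.mlieBracket 𝓘(ℝ, E) X Y x)

/-- The mean curvature `i Λ F`, applied to the section `σ` at `x`, where `Λ` is the contraction with
the fundamental form `ω = g(J ·, ·)`. It is computed in vector fields `e_j` that are supposed to be
`g`-orthonormal at `x`: then `Λ β = (1/2) ∑_j β(e_j, J e_j)` for every `2`-form `β`, so that
`Λ ω = n = dim_ℂ M`. -/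
def meanCurvature (J : ComplexStructure E M) (D : CovariantDerivative 𝓘(ℝ, E) F V)
    (e : Fin (Module.finrank ℝ E) → ∀ x : M, TangentSpace 𝓘(ℝ, E) x) (σ : ∀ x, V x) (x : M) :
    V x :=
  (Complex.I / 2) • ∑ j, curvature D (e j) (fun y => J.J y (e j y)) σ x

variable [ContMDiffVectorBundle ∞ F V 𝓘(ℝ, E)] [FiniteDimensional ℂ F] [FiniteDimensional ℝ E]

/-- The metric `h` is `α`-Hermitian-Einstein with constant `lam`: the curvatures `F₊`, `F₋` of the
Chern connections of `(∂̄₊, h)` and `(∂̄₋, h)` satisfy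
`α i Λ₊ F₊ + (1 - α) i Λ₋ F₋ = lam Id_V`. The endomorphism on the left hand side is tested at each
point `x` on the value `σ x` of a smooth section and in smooth vector fields that are orthonormal
at `x`. -/
def IsHermitianEinstein (B : BiHermitianStructure E M)
    (Dp : HolomorphicStructure F V B.Ip) (Dm : HolomorphicStructure F V B.Im)
    (h : HermitianMetric (E := E) F V) (α lam : ℝ) : Prop :=
  ∀ (x : M) (e : Fin (Module.finrank ℝ E) → ∀ x : M, TangentSpace 𝓘(ℝ, E) x) (σ : ∀ x, V x),
    (∀ j, IsSmoothVF (e j)) →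
    (∀ i j, B.g.inner x (e i x) (e j x) = if i = j then 1 else 0) →
    IsSmoothSection E F σ →
    (α : ℂ) • meanCurvature B.Ip (chernConnection Dp h) e σ x
      + ((1 - α : ℝ) : ℂ) • meanCurvature B.Im (chernConnection Dm h) e σ x
      = (lam : ℂ) • σ x

/-- A global section is `I_±`-holomorphic: it is smooth, and `∂̄₊ s = 0` and `∂̄₋ s = 0`. -/
def IsHolomorphicSection (B : BiHermitianStructure E M)
    (Dp : HolomorphicStructure F V B.Ip) (Dm : HolomorphicStructure F V B.Im)
    (s : ∀ x, V x) : Prop :=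
  IsSmoothSection E F s ∧ (∀ x, Dp.toFun s x = 0) ∧ (∀ x, Dm.toFun s x = 0)

end HermitianEinstein

end Bundles

end BiHerm

end

open Topology Filter

noncomputable section

namespace BiHerm

section Manifold

variable {E : Type*} [NormedAddCommGroup E] [NormedSpace ℝ E]
  {M : Type*} [TopologicalSpace M] [ChartedSpace E M] [IsManifold 𝓘(ℝ, E) ∞ M]

/-- A smooth section over an open set agrees near each point of it with a global smooth section. -/
theorem exists_contMDiff_section_eventuallyEq [FiniteDimensional ℝ E] [T2Space M]
    {F : Type*} [NormedAddCommGroup F] [NormedSpace ℝ F]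
    {V : M → Type*} [TopologicalSpace (TotalSpace F V)]
    [∀ x, AddCommGroup (V x)] [∀ x, Module ℝ (V x)] [∀ x, TopologicalSpace (V x)]
    [FiberBundle F V] [VectorBundle ℝ F V]
    {U : Set M} (hU : IsOpen U) {x : M} (hx : x ∈ U) {σ : ∀ y, V y}
    (hσ : ContMDiffOn 𝓘(ℝ, E) (𝓘(ℝ, E).prod 𝓘(ℝ, F)) ∞ (fun y => TotalSpace.mk' F y (σ y)) U) :
    ∃ τ : ∀ y, V y, ContMDiff 𝓘(ℝ, E) (𝓘(ℝ, E).prod 𝓘(ℝ, F)) ∞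
      (fun y => TotalSpace.mk' F y (τ y)) ∧ ∀ᶠ y in 𝓝 x, τ y = σ y := by
  obtain ⟨ψ, hψU, -⟩ :=
    (SmoothBumpFunction.nhds_basis_support (I := 𝓘(ℝ, E)) (hU.mem_nhds hx)).mem_iff.1
      (hU.mem_nhds hx)
  refine ⟨(ψ : M → ℝ) • σ, ContMDiffOn.smul_section_of_tsupport ψ.contMDiff.contMDiffOn hU hψU hσ, ?_⟩
  filter_upwards [ψ.eventuallyEq_one] with y hy
  simp [hy]

/-- A smooth function on an open set agrees near each point of it with a global smooth function. -/
theorem exists_contMDiff_eventuallyEq [FiniteDimensional ℝ E] [T2Space M]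
    {U : Set M} (hU : IsOpen U) {x : M} (hx : x ∈ U) {f : M → ℝ}
    (hf : ContMDiffOn 𝓘(ℝ, E) 𝓘(ℝ, ℝ) ∞ f U) :
    ∃ f' : M → ℝ, ContMDiff 𝓘(ℝ, E) 𝓘(ℝ, ℝ) ∞ f' ∧ f' =ᶠ[𝓝 x] f := by
  obtain ⟨ψ, hψU, -⟩ :=
    (SmoothBumpFunction.nhds_basis_support (I := 𝓘(ℝ, E)) (hU.mem_nhds hx)).mem_iff.1
      (hU.mem_nhds hx)
  refine ⟨fun y => ψ y * f y, contMDiff_of_tsupport fun y hy => ?_, ?_⟩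
  · have hy' : y ∈ U := hψU (closure_mono (Function.support_mul_subset_left _ _) hy)
    exact ψ.contMDiffAt.mul (hf.contMDiffAt (hU.mem_nhds hy'))
  · filter_upwards [ψ.eventuallyEq_one] with y hy
    simp [hy]

/-- Every vector of a fibre is the value of a global smooth section. -/
theorem exists_contMDiff_section_eq [FiniteDimensional ℝ E] [T2Space M]
    {F : Type*} [NormedAddCommGroup F] [NormedSpace ℝ F] [FiniteDimensional ℝ F]
    {V : M → Type*} [TopologicalSpace (TotalSpace F V)]
    [∀ x, AddCommGroup (V x)] [∀ x, Module ℝ (V x)] [∀ x, TopologicalSpace (V x)]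
    [FiberBundle F V] [VectorBundle ℝ F V] [ContMDiffVectorBundle ∞ F V 𝓘(ℝ, E)]
    {x : M} (v : V x) :
    ∃ τ : ∀ y, V y, ContMDiff 𝓘(ℝ, E) (𝓘(ℝ, E).prod 𝓘(ℝ, F)) ∞
      (fun y => TotalSpace.mk' F y (τ y)) ∧ τ x = v := by
  obtain ⟨U, hU, hσ⟩ := FiberBundle.exists_contMDiffOn_extend (k := ∞) 𝓘(ℝ, E) F v
  obtain ⟨τ, hτ, h⟩ := exists_contMDiff_section_eventuallyEq isOpen_interior
    (mem_interior_iff_mem_nhds.2 hU) (hσ.mono interior_subset)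
  exact ⟨τ, hτ, by simpa using h.self_of_nhds⟩

/-- The derivative of a smooth function along a smooth vector field is smooth. -/
theorem IsSmoothVF.contMDiff_mvfderiv {G : Type*} [NormedAddCommGroup G] [NormedSpace ℝ G]
    {X : ∀ x : M, TangentSpace 𝓘(ℝ, E) x} (hX : IsSmoothVF X) {u : M → G}
    (hu : ContMDiff 𝓘(ℝ, E) 𝓘(ℝ, G) ∞ u) :
    ContMDiff 𝓘(ℝ, E) 𝓘(ℝ, G) ∞ (fun x => mvfderiv 𝓘(ℝ, E) u x (X x)) := by
  have h1 := hu.contMDiff_tangentMap (m := ∞) (by simp)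
  exact ((contMDiff_snd_tangentBundle_modelSpace G 𝓘(ℝ, G)).comp h1).comp hX

theorem ComplexStructure.isSmoothVF (J : ComplexStructure E M)
    {X : ∀ x : M, TangentSpace 𝓘(ℝ, E) x} (hX : IsSmoothVF X) :
    IsSmoothVF (fun x => J.J x (X x)) :=
  J.contMDiff.clm_bundle_apply (b := fun x => x) hX

theorem IsSmoothVF.mlieBracket [CompleteSpace E] {X Y : ∀ x : M, TangentSpace 𝓘(ℝ, E) x}
    (hX : IsSmoothVF X) (hY : IsSmoothVF Y) :
    IsSmoothVF (VectorField.mlieBracket 𝓘(ℝ, E) X Y) := by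
  have : IsManifold 𝓘(ℝ, E) (((⊤ : ℕ∞) : WithTop ℕ∞) + 1) M := by
    simpa using (inferInstance : IsManifold 𝓘(ℝ, E) ∞ M)
  have : IsManifold 𝓘(ℝ, E) (minSmoothness ℝ 2) M :=
    IsManifold.of_le (n := ∞) (by
      rw [minSmoothness_of_isRCLikeNormedField]; exact WithTop.coe_le_coe.2 le_top)
  have : IsManifold 𝓘(ℝ, E) (minSmoothness ℝ 3) M :=
    IsManifold.of_le (n := ∞) (by
      rw [minSmoothness_of_isRCLikeNormedField]; exact WithTop.coe_le_coe.2 le_top)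
  intro x
  exact ContMDiffAt.mlieBracket_vectorField (m := ⊤) (n := ⊤) (hX x) (hY x) (by simp)

theorem _root_.ContMDiff.mdiffAt {N G : Type*} [NormedAddCommGroup G] [NormedSpace ℝ G]
    [TopologicalSpace N] [ChartedSpace G N] {f : M → N}
    (hf : ContMDiff 𝓘(ℝ, E) 𝓘(ℝ, G) ∞ f) (x : M) : MDifferentiableAt 𝓘(ℝ, E) 𝓘(ℝ, G) f x :=
  (hf x).mdifferentiableAt (by simp)

/-- Through every point there is a curve along which the derivative of every smooth function is its
derivative along a given smooth vector field. -/
theorem IsSmoothVF.exists_curve [CompleteSpace E] {X : ∀ x : M, TangentSpace 𝓘(ℝ, E) x}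
    (hX : IsSmoothVF X) (p : M) :
    ∃ γ : ℝ → M, γ 0 = p ∧ ContinuousAt γ 0 ∧ ∀ᶠ t in 𝓝 (0 : ℝ), ∀ w : M → ℝ,
      ContMDiff 𝓘(ℝ, E) 𝓘(ℝ, ℝ) ∞ w →
        HasDerivAt (w ∘ γ) (mvfderiv 𝓘(ℝ, E) w (γ t) (X (γ t))) t := by
  obtain ⟨γ, hγ0, hγ⟩ := exists_isMIntegralCurveAt_of_contMDiffAt_boundaryless (t₀ := 0)
    ((hX p).of_le (by simp) : ContMDiffAt 𝓘(ℝ, E) _ 1 _ p)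
  refine ⟨γ, hγ0, hγ.self_of_nhds.continuousAt, ?_⟩
  filter_upwards [hγ] with t ht w hw
  have h1 := (hw.mdiffAt (γ t)).hasMFDerivAt.comp t ht
  have h2 : HasFDerivAt (w ∘ γ) ((mvfderiv 𝓘(ℝ, E) w (γ t)).comp
      ((1 : ℝ →L[ℝ] ℝ).smulRight (X (γ t)))) t := h1.hasFDerivAt
  have h3 := h2.hasDerivAt
  have e : ((mvfderiv 𝓘(ℝ, E) w (γ t)).comp ((1 : ℝ →L[ℝ] ℝ).smulRight (X (γ t)))) (1 : ℝ)
      = mvfderiv 𝓘(ℝ, E) w (γ t) (X (γ t)) := by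
    rw [ContinuousLinearMap.comp_apply, ContinuousLinearMap.smulRight_apply]
    simp
  rwa [e] at h3

/-- A smooth function has vanishing derivatives at a local maximum. -/
theorem mvfderiv_eq_zero_of_isLocalMax [CompleteSpace E] {u : M → ℝ}
    (hu : ContMDiff 𝓘(ℝ, E) 𝓘(ℝ, ℝ) ∞ u) {p : M} (hp : IsLocalMax u p)
    {X : ∀ x : M, TangentSpace 𝓘(ℝ, E) x} (hX : IsSmoothVF X) :
    mvfderiv 𝓘(ℝ, E) u p (X p) = 0 := by
  obtain ⟨γ, rfl, hc, hγ⟩ := hX.exists_curve p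
  have hmax : IsLocalMax (u ∘ γ) 0 := hc.eventually hp
  exact hmax.hasDerivAt_eq_zero (hγ.self_of_nhds u hu)

/-- The second derivative of a function along a vector field is nonpositive at a local maximum. -/
theorem mvfderiv_mvfderiv_nonpos_of_isLocalMax [CompleteSpace E] {u : M → ℝ}
    (hu : ContMDiff 𝓘(ℝ, E) 𝓘(ℝ, ℝ) ∞ u) {X : ∀ x : M, TangentSpace 𝓘(ℝ, E) x}
    (hX : IsSmoothVF X) {p : M} (hp : IsLocalMax u p) :
    mvfderiv 𝓘(ℝ, E) (fun x => mvfderiv 𝓘(ℝ, E) u x (X x)) p (X p) ≤ 0 := by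
  obtain ⟨γ, rfl, hc, hγ⟩ := hX.exists_curve p
  have hmax : IsLocalMax (u ∘ γ) 0 := hc.eventually hp
  have e : deriv (u ∘ γ) =ᶠ[𝓝 0] ((fun x => mvfderiv 𝓘(ℝ, E) u x (X x)) ∘ γ) :=
    hγ.mono fun t ht => (ht u hu).deriv
  rw [← (hγ.self_of_nhds _ (hX.contMDiff_mvfderiv hu)).deriv, ← e.deriv_eq]
  by_contra! hpos
  have hmin := isLocalMin_of_deriv_deriv_pos hpos hmax.deriv_eq_zero
    (hγ.self_of_nhds u hu).continuousAt
  have hconst : u ∘ γ =ᶠ[𝓝 0] fun _ => (u ∘ γ) 0 := by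
    filter_upwards [hmax, hmin] with t h1 h2 using le_antisymm h1 h2
  have h3 : deriv (deriv (u ∘ γ)) 0 = 0 := by
    rw [hconst.deriv.deriv_eq]
    simp
  exact hpos.ne' h3

end Manifold

section LinearAlgebra

variable {W : Type*} [AddCommGroup W] [Module ℝ W] [FiniteDimensional ℝ W]

theorem linearMap_eq_zero_of_orthonormal {G : Type*} [AddCommGroup G] [Module ℝ G]
    (b : W →ₗ[ℝ] W →ₗ[ℝ] ℝ) (e : Fin (Module.finrank ℝ W) → W)
    (he : ∀ i j, b (e i) (e j) = if i = j then 1 else 0) (L : W →ₗ[ℝ] G)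
    (hL : ∀ j, L (e j) = 0) : L = 0 := by
  have hli : LinearIndependent ℝ e := by
    rw [Fintype.linearIndependent_iff]
    intro c hc i
    have := congrArg (b (e i)) hc
    simpa [he] using this
  have hspan := hli.span_eq_top_of_card_eq_finrank' (by simp)
  exact LinearMap.ext_on_range hspan (by simpa using hL)

theorem exists_unit_orthogonal (b : W →ₗ[ℝ] W →ₗ[ℝ] ℝ) (hb : ∀ w, w ≠ 0 → 0 < b w w)
    {k : ℕ} (hk : k < Module.finrank ℝ W) (e : Fin k → W) :
    ∃ w, b w w = 1 ∧ ∀ i, b (e i) w = 0 := by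
  have hker : LinearMap.ker (LinearMap.pi fun i => b (e i)) ≠ ⊥ :=
    LinearMap.ker_ne_bot_of_finrank_lt (by simpa using hk)
  obtain ⟨w, hw, hw0⟩ := (Submodule.ne_bot_iff _).1 hker
  have hw' : ∀ i, b (e i) w = 0 := fun i => congrFun (LinearMap.mem_ker.1 hw) i
  have hpos := hb w hw0
  refine ⟨(Real.sqrt (b w w))⁻¹ • w, ?_, fun i => by simp [hw' i]⟩
  have hs := Real.sqrt_pos.2 hpos
  simp only [map_smul, LinearMap.smul_apply, smul_eq_mul]
  field_simp
  rw [Real.sq_sqrt hpos.le]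

end LinearAlgebra

section Frame

variable {E : Type*} [NormedAddCommGroup E] [NormedSpace ℝ E] [FiniteDimensional ℝ E]
  {M : Type*} [TopologicalSpace M] [ChartedSpace E M] [IsManifold 𝓘(ℝ, E) ∞ M] [T2Space M]
  {F : Type*} [NormedAddCommGroup F] [NormedSpace ℝ F]
  {V : M → Type*} [TopologicalSpace (TotalSpace F V)]
  [∀ x, AddCommGroup (V x)] [∀ x, Module ℝ (V x)] [∀ x, TopologicalSpace (V x)]
  [FiberBundle F V] [VectorBundle ℝ F V] [ContMDiffVectorBundle ∞ F V 𝓘(ℝ, E)]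
  (b : ∀ x : M, V x →ₗ[ℝ] V x →ₗ[ℝ] ℝ)
  (hb : ∀ σ τ : ∀ x, V x,
    ContMDiff 𝓘(ℝ, E) (𝓘(ℝ, E).prod 𝓘(ℝ, F)) ∞ (fun y => TotalSpace.mk' F y (σ y)) →
    ContMDiff 𝓘(ℝ, E) (𝓘(ℝ, E).prod 𝓘(ℝ, F)) ∞ (fun y => TotalSpace.mk' F y (τ y)) →
    ContMDiff 𝓘(ℝ, E) 𝓘(ℝ, ℝ) ∞ (fun x => b x (σ x) (τ x)))

include hb in
/-- A smooth section of unit length at a point can be normalized near this point. -/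
theorem exists_unit_section {τ : ∀ x, V x}
    (hτ : ContMDiff 𝓘(ℝ, E) (𝓘(ℝ, E).prod 𝓘(ℝ, F)) ∞ (fun y => TotalSpace.mk' F y (τ y))) {x : M}
    (hx : b x (τ x) (τ x) = 1) :
    ∃ σ : ∀ x, V x,
      ContMDiff 𝓘(ℝ, E) (𝓘(ℝ, E).prod 𝓘(ℝ, F)) ∞ (fun y => TotalSpace.mk' F y (σ y)) ∧
      ∀ᶠ y in 𝓝 x, b y (σ y) (σ y) = 1 ∧ ∃ c : ℝ, σ y = c • τ y := by
  have hq := hb τ τ hτ hτ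
  set q : M → ℝ := fun y => b y (τ y) (τ y) with hqdef
  have hU : IsOpen {y | 0 < q y} := isOpen_lt continuous_const hq.continuous
  have hxU : x ∈ {y | 0 < q y} := by simp [hqdef, hx]
  have hφ : ContMDiffOn 𝓘(ℝ, E) 𝓘(ℝ, ℝ) ∞ (fun y => (Real.sqrt (q y))⁻¹) {y | 0 < q y} := by
    intro y hy
    have h1 : ContDiffAt ℝ ∞ (fun t : ℝ => (Real.sqrt t)⁻¹) (q y) :=
      (Real.contDiffAt_sqrt (ne_of_gt hy)).inv (Real.sqrt_pos.2 hy).ne'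
    exact (ContMDiffAt.comp y h1.contMDiffAt (hq y)).contMDiffWithinAt
  obtain ⟨σ, hσ, hσe⟩ := exists_contMDiff_section_eventuallyEq hU hxU
    (ContMDiffOn.smul_section hφ hτ.contMDiffOn)
  refine ⟨σ, hσ, ?_⟩
  filter_upwards [hσe, hU.mem_nhds hxU] with y hy hyU
  have hs := Real.sqrt_pos.2 hyU
  have hy' : σ y = (Real.sqrt (q y))⁻¹ • τ y := hy
  refine ⟨?_, (Real.sqrt (q y))⁻¹, hy'⟩
  rw [hy']
  have : b y ((Real.sqrt (q y))⁻¹ • τ y) ((Real.sqrt (q y))⁻¹ • τ y)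
      = (Real.sqrt (q y))⁻¹ * ((Real.sqrt (q y))⁻¹ * q y) := by
    simp [hqdef]
  rw [this]
  field_simp
  rw [Real.sq_sqrt hyU.le]

variable [FiniteDimensional ℝ F] (hsymm : ∀ x v w, b x v w = b x w v)
  (hpos : ∀ x v, v ≠ 0 → 0 < b x v v)

include hb hsymm hpos in
/-- Near every point there are smooth orthonormal frames, made up of global sections. -/
theorem exists_orthonormal_sections (x : M) (k : ℕ) (hk : k ≤ Module.finrank ℝ F) :
    ∃ e : Fin k → ∀ x, V x,
      (∀ j, ContMDiff 𝓘(ℝ, E) (𝓘(ℝ, E).prod 𝓘(ℝ, F)) ∞ (fun y => TotalSpace.mk' F y (e j y))) ∧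
      ∀ᶠ y in 𝓝 x, ∀ i j, b y (e i y) (e j y) = if i = j then 1 else 0 := by
  induction k with
  | zero => exact ⟨fun i => i.elim0, fun i => i.elim0, Eventually.of_forall fun _ i => i.elim0⟩
  | succ k ih =>
    obtain ⟨e, he, hor⟩ := ih (by omega)
    have : FiniteDimensional ℝ (V x) := VectorBundle.finiteDimensional ℝ F V x
    have hfr : Module.finrank ℝ (V x) = Module.finrank ℝ F :=
      (VectorBundle.continuousLinearEquivAt ℝ F V x).toLinearEquiv.finrank_eq
    obtain ⟨w, hw1, hw⟩ := exists_unit_orthogonal (b x) (hpos x) (k := k) (by omega)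
      (fun i => e i x)
    obtain ⟨W, hW, hWx⟩ := exists_contMDiff_section_eq (E := E) (F := F) w
    have hW' : ContMDiff 𝓘(ℝ, E) (𝓘(ℝ, E).prod 𝓘(ℝ, F)) ∞
        (fun y => TotalSpace.mk' F y (W y - ∑ i, b y (e i y) (W y) • e i y)) :=
      ContMDiff.sub_section hW
        (ContMDiff.sum_section fun i _ => ContMDiff.smul_section (hb _ _ (he i) hW) (he i))
    obtain ⟨X, hX, hXe⟩ := exists_unit_section b hb hW' (x := x) (by simp [hWx, hw, hw1])
    refine ⟨Fin.snoc e X, fun j => ?_, ?_⟩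
    · refine Fin.lastCases ?_ (fun j => ?_) j
      · simpa using hX
      · simpa using he j
    · filter_upwards [hor, hXe] with y hy hXy
      obtain ⟨hXX, c, hc⟩ := hXy
      have hort : ∀ i, b y (e i y) (X y) = 0 := by
        intro i
        rw [hc]
        simp [hy]
      intro i j
      refine Fin.lastCases ?_ (fun i => ?_) i <;> refine Fin.lastCases ?_ (fun j => ?_) j
      · simpa using hXX
      · rw [if_neg (Fin.castSucc_lt_last j).ne', hsymm]
        simpa using hort j
      · rw [if_neg (Fin.castSucc_lt_last i).ne]
        simpa using hort i
      · simpa using hy i j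

include hb hsymm hpos in
/-- A section is differentiable if its inner products with all smooth sections are. -/
theorem mdifferentiableAt_section_of_inner {σ : ∀ x, V x} {x : M}
    (hσ : ∀ τ : ∀ x, V x,
      ContMDiff 𝓘(ℝ, E) (𝓘(ℝ, E).prod 𝓘(ℝ, F)) ∞ (fun y => TotalSpace.mk' F y (τ y)) →
      MDifferentiableAt 𝓘(ℝ, E) 𝓘(ℝ, ℝ) (fun y => b y (σ y) (τ y)) x) :
    MDifferentiableAt 𝓘(ℝ, E) (𝓘(ℝ, E).prod 𝓘(ℝ, F)) (fun y => TotalSpace.mk' F y (σ y)) x := by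
  obtain ⟨e, he, hor⟩ := exists_orthonormal_sections b hb hsymm hpos x _ le_rfl
  have h1 : MDifferentiableAt 𝓘(ℝ, E) (𝓘(ℝ, E).prod 𝓘(ℝ, F))
      (fun y => TotalSpace.mk' F y (∑ j, b y (σ y) (e j y) • e j y)) x :=
    .sum_section fun j _ => (hσ _ (he j)).smul_section ((he j x).mdifferentiableAt (by simp))
  refine h1.congr_of_eventuallyEq ?_
  filter_upwards [hor] with y hy
  have : FiniteDimensional ℝ (V y) := VectorBundle.finiteDimensional ℝ F V y
  have hfr : Module.finrank ℝ (V y) = Module.finrank ℝ F :=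
    (VectorBundle.continuousLinearEquivAt ℝ F V y).toLinearEquiv.finrank_eq
  let L : V y →ₗ[ℝ] V y := LinearMap.id - ∑ j, ((b y).flip (e j y)).smulRight (e j y)
  have hL : L = 0 := by
    refine linearMap_eq_zero_of_orthonormal (b y) (fun j => e (Fin.cast hfr j) y)
      (fun i j => by simp [hy]) L fun j => ?_
    simp [L, hy, LinearMap.sum_apply]
  have h2 := LinearMap.congr_fun hL (σ y)
  simp only [L, LinearMap.sub_apply, LinearMap.sum_apply, LinearMap.smulRight_apply,
    LinearMap.flip_apply, LinearMap.id_apply, LinearMap.zero_apply, sub_eq_zero] at h2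
  rw [← h2]

end Frame

section RiemannianMetric

variable {E : Type*} [NormedAddCommGroup E] [NormedSpace ℝ E]
  {M : Type*} [TopologicalSpace M] [ChartedSpace E M] [IsManifold 𝓘(ℝ, E) ∞ M]
  (g : ContMDiffRiemannianMetric 𝓘(ℝ, E) ∞ E (fun x : M => TangentSpace 𝓘(ℝ, E) x))

theorem IsSmoothVF.contMDiff_inner {X Y : ∀ x : M, TangentSpace 𝓘(ℝ, E) x}
    (hX : IsSmoothVF X) (hY : IsSmoothVF Y) :
    ContMDiff 𝓘(ℝ, E) 𝓘(ℝ, ℝ) ∞ (fun x => g.inner x (X x) (Y x)) := by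
  have : ContMDiff 𝓘(ℝ, E) (𝓘(ℝ, E).prod 𝓘(ℝ, ℝ)) ∞
      (fun x => TotalSpace.mk' ℝ (E := Bundle.Trivial M ℝ) x (g.inner x (X x) (Y x))) :=
    ContMDiff.clm_bundle_apply₂ (F₁ := E) (F₂ := E) (b := fun y : M => y) g.contMDiff hX hY
  intro x
  have := this x
  simp only [contMDiffAt_totalSpace] at this
  exact this.2

/-- The bilinear form of a Riemannian metric on a tangent space. -/
def innerForm (x : M) :
    TangentSpace 𝓘(ℝ, E) x →ₗ[ℝ] TangentSpace 𝓘(ℝ, E) x →ₗ[ℝ] ℝ :=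
  LinearMap.mk₂ ℝ (fun v w => g.inner x v w)
    (fun v v' w => by simp) (fun c v w => by simp) (fun v w w' => by simp) (fun c v w => by simp)

variable [FiniteDimensional ℝ E]

theorem eq_zero_of_orthonormal {G : Type*} [AddCommGroup G] [Module ℝ G]
    {x : M} (e : Fin (Module.finrank ℝ E) → TangentSpace 𝓘(ℝ, E) x)
    (he : ∀ i j, g.inner x (e i) (e j) = if i = j then 1 else 0)
    (L : TangentSpace 𝓘(ℝ, E) x →ₗ[ℝ] G) (hL : ∀ j, L (e j) = 0) : L = 0 :=
  have : FiniteDimensional ℝ (TangentSpace 𝓘(ℝ, E) x) := inferInstanceAs (FiniteDimensional ℝ E)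
  linearMap_eq_zero_of_orthonormal (W := TangentSpace 𝓘(ℝ, E) x) (innerForm g x) e he L hL

theorem exists_orthonormal_fields [T2Space M] (x : M) :
    ∃ e : Fin (Module.finrank ℝ E) → ∀ x : M, TangentSpace 𝓘(ℝ, E) x, (∀ j, IsSmoothVF (e j)) ∧
      ∀ᶠ y in 𝓝 x, ∀ i j, g.inner y (e i y) (e j y) = if i = j then 1 else 0 :=
  exists_orthonormal_sections (innerForm g)
    (fun σ τ hσ hτ => IsSmoothVF.contMDiff_inner g (X := σ) (Y := τ) hσ hτ) g.symm g.pos x _ le_rfl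

end RiemannianMetric

section MaximumPrinciple

theorem exists_isLocalMax_add_mul {T : Type*} [TopologicalSpace T] [LocallyCompactSpace T]
    [T2Space T] {u v : T → ℝ} (hu : Continuous u) (hv : Continuous v) {x : T} {N : Set T}
    (hN : N ∈ 𝓝 x) (huN : ∀ y ∈ N, u y ≤ u x) (hvx : v x = 0)
    (hvN : ∀ y ∈ N, u y = u x → y ≠ x → v y < 0) :
    ∃ ε > 0, ∃ p ∈ N, IsLocalMax (fun y => u y + ε * v y) p := by
  obtain ⟨K, hKx, hKN, hK⟩ := local_compact_nhds hN
  have hxK : x ∈ interior K := mem_interior_iff_mem_nhds.2 hKx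
  have hS : IsCompact ((K \ interior K) ∩ {y | 0 ≤ v y}) :=
    (hK.diff isOpen_interior).inter_right (isClosed_le continuous_const hv)
  have hlt : ∀ y ∈ (K \ interior K) ∩ {y | 0 ≤ v y}, u y < u x := by
    rintro y ⟨⟨hyK, hyi⟩, hy0⟩
    refine lt_of_le_of_ne (huN y (hKN hyK)) fun h => ?_
    have := hvN y (hKN hyK) h (by rintro rfl; exact hyi hxK)
    exact absurd hy0 (not_le.2 this)
  have hcont : ContinuousOn (fun y => v y / (u x - u y)) ((K \ interior K) ∩ {y | 0 ≤ v y}) :=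
    hv.continuousOn.div (continuous_const.sub hu).continuousOn
      fun y hy => (sub_pos.2 (hlt y hy)).ne'
  obtain ⟨C, hC⟩ := hS.bddAbove_image hcont
  have hε : 0 < 1 / (|C| + 1) := by positivity
  refine ⟨1 / (|C| + 1), hε, ?_⟩
  have hfr : ∀ y ∈ K, y ∉ interior K → u y + 1 / (|C| + 1) * v y < u x := by
    intro y hyK hyi
    by_cases hy0 : 0 ≤ v y
    · have hpos := sub_pos.2 (hlt y ⟨⟨hyK, hyi⟩, hy0⟩)
      have h1 : v y / (u x - u y) ≤ C := hC (Set.mem_image_of_mem _ ⟨⟨hyK, hyi⟩, hy0⟩)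
      have h2 : v y / (u x - u y) < |C| + 1 := by linarith [le_abs_self C]
      rw [div_lt_iff₀ hpos] at h2
      have h3 : 1 / (|C| + 1) * v y < u x - u y := by
        rw [one_div, inv_mul_lt_iff₀ (by positivity)]
        exact h2
      linarith
    · have := mul_neg_of_pos_of_neg hε (not_le.1 hy0)
      linarith [huN y (hKN hyK)]
  obtain ⟨p, hpK, hp⟩ := hK.exists_isMaxOn ⟨x, interior_subset hxK⟩
    (hu.add (continuous_const.mul hv)).continuousOn (f := fun y => u y + 1 / (|C| + 1) * v y)
  refine ⟨p, hKN hpK, ?_⟩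
  have hpi : p ∈ interior K := by
    by_contra hpi
    have h1 := hfr p hpK hpi
    have h2 := hp (interior_subset hxK)
    simp only [Set.mem_ofPred_eq, hvx, mul_zero, add_zero] at h2
    linarith
  exact hp.isLocalMax (mem_interior_iff_mem_nhds.1 hpi)

variable {E : Type*} [NormedAddCommGroup E] [NormedSpace ℝ E]
  {M : Type*} [TopologicalSpace M] [ChartedSpace E M] [IsManifold 𝓘(ℝ, E) ∞ M]

theorem mvfderiv_add_const_mul {u w : M → ℝ} {x : M} (hu : MDifferentiableAt 𝓘(ℝ, E) 𝓘(ℝ, ℝ) u x)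
    (hw : MDifferentiableAt 𝓘(ℝ, E) 𝓘(ℝ, ℝ) w x) (c : ℝ) (v : TangentSpace 𝓘(ℝ, E) x) :
    mvfderiv 𝓘(ℝ, E) (fun y => u y + c * w y) x v
      = mvfderiv 𝓘(ℝ, E) u x v + c * mvfderiv 𝓘(ℝ, E) w x v := by
  have hcw : MDifferentiableAt 𝓘(ℝ, E) 𝓘(ℝ, ℝ) ((fun _ : M => c) * w) x :=
    mdifferentiableAt_const.mul hw
  have e : (fun y => u y + c * w y) = u + (fun _ : M => c) * w := rfl
  rw [e, mvfderiv_add hu hcw, mvfderiv_mul mdifferentiableAt_const hw, mvfderiv_const]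
  simp

theorem mvfderiv_mul_apply {u w : M → ℝ} {x : M} (hu : MDifferentiableAt 𝓘(ℝ, E) 𝓘(ℝ, ℝ) u x)
    (hw : MDifferentiableAt 𝓘(ℝ, E) 𝓘(ℝ, ℝ) w x) (v : TangentSpace 𝓘(ℝ, E) x) :
    mvfderiv 𝓘(ℝ, E) (fun y => u y * w y) x v
      = u x * mvfderiv 𝓘(ℝ, E) w x v + w x * mvfderiv 𝓘(ℝ, E) u x v := by
  have e : (fun y => u y * w y) = u * w := rfl
  rw [e, mvfderiv_mul hu hw]
  simp

/-- The value `X(Xu) + JX(JXu) + (J[X, JX])u` of the form `dd^c u` on the pair `(X, JX)`. -/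
def ComplexStructure.ddc (J : ComplexStructure E M) (X : ∀ x : M, TangentSpace 𝓘(ℝ, E) x)
    (u : M → ℝ) (x : M) : ℝ :=
  mvfderiv 𝓘(ℝ, E) (fun y => mvfderiv 𝓘(ℝ, E) u y (X y)) x (X x)
    + mvfderiv 𝓘(ℝ, E) (fun y => mvfderiv 𝓘(ℝ, E) u y (J.J y (X y))) x (J.J x (X x))
    + mvfderiv 𝓘(ℝ, E) u x
      (J.J x (VectorField.mlieBracket 𝓘(ℝ, E) X (fun y => J.J y (X y)) x))

namespace ComplexStructure

variable (J : ComplexStructure E M) {X : ∀ x : M, TangentSpace 𝓘(ℝ, E) x} (hX : IsSmoothVF X)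
include hX

theorem continuous_ddc [CompleteSpace E] {u : M → ℝ} (hu : ContMDiff 𝓘(ℝ, E) 𝓘(ℝ, ℝ) ∞ u) :
    Continuous (J.ddc X u) := by
  have hJX := J.isSmoothVF hX
  exact (((hX.contMDiff_mvfderiv (hX.contMDiff_mvfderiv hu)).continuous.add
    (hJX.contMDiff_mvfderiv (hJX.contMDiff_mvfderiv hu)).continuous).add
    ((J.isSmoothVF (hX.mlieBracket hJX)).contMDiff_mvfderiv hu).continuous)

theorem ddc_nonpos_of_isLocalMax [CompleteSpace E] {u : M → ℝ}
    (hu : ContMDiff 𝓘(ℝ, E) 𝓘(ℝ, ℝ) ∞ u) {p : M} (hp : IsLocalMax u p) : J.ddc X u p ≤ 0 := by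
  have hJX := J.isSmoothVF hX
  have h1 := mvfderiv_mvfderiv_nonpos_of_isLocalMax hu hX hp
  have h2 := mvfderiv_mvfderiv_nonpos_of_isLocalMax hu hJX hp
  have h3 := mvfderiv_eq_zero_of_isLocalMax hu hp (J.isSmoothVF (hX.mlieBracket hJX))
  unfold ddc
  rw [h3]
  linarith

theorem ddc_add_const_mul {u v : M → ℝ} (hu : ContMDiff 𝓘(ℝ, E) 𝓘(ℝ, ℝ) ∞ u)
    (hv : ContMDiff 𝓘(ℝ, E) 𝓘(ℝ, ℝ) ∞ v) (c : ℝ) (x : M) :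
    J.ddc X (fun y => u y + c * v y) x = J.ddc X u x + c * J.ddc X v x := by
  have hJX := J.isSmoothVF hX
  simp only [ddc, mvfderiv_add_const_mul (hu.mdiffAt _) (hv.mdiffAt _)]
  rw [mvfderiv_add_const_mul ((hX.contMDiff_mvfderiv hu).mdiffAt x)
      ((hX.contMDiff_mvfderiv hv).mdiffAt x),
    mvfderiv_add_const_mul ((hJX.contMDiff_mvfderiv hu).mdiffAt x)
      ((hJX.contMDiff_mvfderiv hv).mdiffAt x)]
  ring

theorem ddc_mul_self {u : M → ℝ} (hu : ContMDiff 𝓘(ℝ, E) 𝓘(ℝ, ℝ) ∞ u) {x : M} (hx : u x = 0) :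
    J.ddc X (fun y => u y * u y) x = 2 * (mvfderiv 𝓘(ℝ, E) u x (X x)) ^ 2
      + 2 * (mvfderiv 𝓘(ℝ, E) u x (J.J x (X x))) ^ 2 := by
  have hJX := J.isSmoothVF hX
  have key : ∀ {Y : ∀ x : M, TangentSpace 𝓘(ℝ, E) x}, IsSmoothVF Y →
      mvfderiv 𝓘(ℝ, E) (fun y => u y * mvfderiv 𝓘(ℝ, E) u y (Y y)
        + u y * mvfderiv 𝓘(ℝ, E) u y (Y y)) x (Y x)
      = 2 * (mvfderiv 𝓘(ℝ, E) u x (Y x)) ^ 2 := by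
    intro Y hY
    have h1 := (hY.contMDiff_mvfderiv hu).mdiffAt x
    have h2 : MDifferentiableAt 𝓘(ℝ, E) 𝓘(ℝ, ℝ) (fun y => u y * mvfderiv 𝓘(ℝ, E) u y (Y y)) x :=
      (hu.mdiffAt x).mul h1
    have := mvfderiv_add_const_mul h2 h2 1 (Y x)
    simp only [one_mul] at this
    rw [this, mvfderiv_mul_apply (hu.mdiffAt x) h1, hx]
    ring
  simp only [ddc, mvfderiv_mul_apply (hu.mdiffAt _) (hu.mdiffAt _)]
  rw [key hX, key hJX, hx]
  ring

end ComplexStructure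

namespace BiHermitianStructure

variable (B : BiHermitianStructure E M) (α : ℝ)

/-- The second order operator `∑_j (α dd^c₊ u(e_j, I₊ e_j) + (1 - α) dd^c₋ u(e_j, I₋ e_j))`. -/
def lap (e : Fin (Module.finrank ℝ E) → ∀ x : M, TangentSpace 𝓘(ℝ, E) x) (u : M → ℝ) (x : M) : ℝ :=
  ∑ j, (α * B.Ip.ddc (e j) u x + (1 - α) * B.Im.ddc (e j) u x)

variable {α} {e : Fin (Module.finrank ℝ E) → ∀ x : M, TangentSpace 𝓘(ℝ, E) x}
  (he : ∀ j, IsSmoothVF (e j))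
include he

theorem continuous_lap [CompleteSpace E] {u : M → ℝ} (hu : ContMDiff 𝓘(ℝ, E) 𝓘(ℝ, ℝ) ∞ u) :
    Continuous (B.lap α e u) :=
  continuous_finsetSum _ fun j _ => (continuous_const.mul (B.Ip.continuous_ddc (he j) hu)).add
    (continuous_const.mul (B.Im.continuous_ddc (he j) hu))

theorem lap_add_const_mul {u v : M → ℝ} (hu : ContMDiff 𝓘(ℝ, E) 𝓘(ℝ, ℝ) ∞ u)
    (hv : ContMDiff 𝓘(ℝ, E) 𝓘(ℝ, ℝ) ∞ v) (c : ℝ) (x : M) :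
    B.lap α e (fun y => u y + c * v y) x = B.lap α e u x + c * B.lap α e v x := by
  simp only [lap, ComplexStructure.ddc_add_const_mul _ (he _) hu hv, Finset.mul_sum,
    ← Finset.sum_add_distrib]
  exact Finset.sum_congr rfl fun j _ => by ring

theorem lap_nonpos_of_isLocalMax [CompleteSpace E] (hα : α ∈ Set.Icc (0 : ℝ) 1) {u : M → ℝ}
    (hu : ContMDiff 𝓘(ℝ, E) 𝓘(ℝ, ℝ) ∞ u) {p : M} (hp : IsLocalMax u p) : B.lap α e u p ≤ 0 :=
  Finset.sum_nonpos fun j _ => add_nonpos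
    (mul_nonpos_of_nonneg_of_nonpos hα.1 (B.Ip.ddc_nonpos_of_isLocalMax (he j) hu hp))
    (mul_nonpos_of_nonneg_of_nonpos (sub_nonneg.2 hα.2)
      (B.Im.ddc_nonpos_of_isLocalMax (he j) hu hp))

theorem lap_mul_self_pos [FiniteDimensional ℝ E] (hα : α ∈ Set.Icc (0 : ℝ) 1) {τ : M → ℝ}
    (hτ : ContMDiff 𝓘(ℝ, E) 𝓘(ℝ, ℝ) ∞ τ) {x : M} (hx : τ x = 0)
    (hdτ : mvfderiv 𝓘(ℝ, E) τ x ≠ 0)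
    (hor : ∀ i j, B.g.inner x (e i x) (e j x) = if i = j then 1 else 0) :
    0 < B.lap α e (fun y => τ y * τ y) x := by
  have hj : ∃ j, mvfderiv 𝓘(ℝ, E) τ x (e j x) ≠ 0 := by
    by_contra! h
    apply hdτ
    have := eq_zero_of_orthonormal B.g (fun j => e j x) hor (mvfderiv 𝓘(ℝ, E) τ x).toLinearMap h
    ext v
    exact LinearMap.congr_fun this v
  obtain ⟨j, hj⟩ := hj
  have h0 := hα.1
  have h1 : 0 ≤ 1 - α := sub_nonneg.2 hα.2
  simp only [lap, ComplexStructure.ddc_mul_self _ (he _) hτ hx]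
  refine Finset.sum_pos' (fun i _ => by positivity) ⟨j, Finset.mem_univ j, ?_⟩
  have h2 : 0 < (mvfderiv 𝓘(ℝ, E) τ x (e j x)) ^ 2 := by positivity
  nlinarith [mul_nonneg h0 (sq_nonneg (mvfderiv 𝓘(ℝ, E) τ x (B.Ip.J x (e j x)))),
    mul_nonneg h1 (sq_nonneg (mvfderiv 𝓘(ℝ, E) τ x (B.Im.J x (e j x))))]

omit he in
/-- A maximum of a subsolution cannot touch a regular level set of a smooth function from one
side. -/
theorem not_touching [FiniteDimensional ℝ E] [T2Space M] (hα : α ∈ Set.Icc (0 : ℝ) 1) {u : M → ℝ}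
    (hu : ContMDiff 𝓘(ℝ, E) 𝓘(ℝ, ℝ) ∞ u)
    (hsub : ∀ (x : M) (e : Fin (Module.finrank ℝ E) → ∀ x : M, TangentSpace 𝓘(ℝ, E) x),
      (∀ j, IsSmoothVF (e j)) →
      (∀ i j, B.g.inner x (e i x) (e j x) = if i = j then 1 else 0) → 0 ≤ B.lap α e u x)
    {x : M} (hmax : IsLocalMax u x) {τ : M → ℝ} (hτ : ContMDiff 𝓘(ℝ, E) 𝓘(ℝ, ℝ) ∞ τ)
    (hx : τ x = 0) (hdτ : mvfderiv 𝓘(ℝ, E) τ x ≠ 0)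
    (hpos : ∀ᶠ y in 𝓝 x, u y = u x → y ≠ x → 0 < τ y) : False := by
  have : LocallyCompactSpace M := Manifold.locallyCompact_of_finiteDimensional 𝓘(ℝ, E)
  have : CompleteSpace E := FiniteDimensional.complete ℝ E
  obtain ⟨e, he, hor⟩ := exists_orthonormal_fields B.g x
  have hτ2 : ContMDiff 𝓘(ℝ, E) 𝓘(ℝ, ℝ) ∞ (fun y => τ y * τ y) := hτ.mul hτ
  have hσ := B.lap_mul_self_pos he hα hτ hx hdτ hor.self_of_nhds
  set σ := B.lap α e (fun y => τ y * τ y) x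
  set b := (|B.lap α e τ x| + 1) / σ with hb
  have hb0 : 0 < b := by positivity
  have hv0 : ContMDiff 𝓘(ℝ, E) 𝓘(ℝ, ℝ) ∞ (fun y => b * (τ y * τ y)) := contMDiff_const.mul hτ2
  set v : M → ℝ := fun y => b * (τ y * τ y) + (-1) * τ y with hvdef
  have hv : ContMDiff 𝓘(ℝ, E) 𝓘(ℝ, ℝ) ∞ v := hv0.add (contMDiff_const.mul hτ)
  have hlapv : 0 < B.lap α e v x := by
    have h0 : ContMDiff 𝓘(ℝ, E) 𝓘(ℝ, ℝ) ∞ (fun _ : M => (0 : ℝ)) := contMDiff_const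
    have h1 := B.lap_add_const_mul (α := α) he h0 hτ2 b x
    have h2 := B.lap_add_const_mul (α := α) he hv0 hτ (-1) x
    have h3 := B.lap_add_const_mul (α := α) he h0 h0 (-1) x
    simp only [zero_add, mul_zero] at h1 h3
    have h4 : b * σ = |B.lap α e τ x| + 1 := div_mul_cancel₀ _ hσ.ne'
    rw [hvdef, h2, h1]
    linarith [le_abs_self (B.lap α e τ x)]
  have hsmall : ∀ᶠ y in 𝓝 x, τ y < 1 / b :=
    hτ.continuous.continuousAt.eventually_lt continuousAt_const (by rw [hx]; positivity)
  have hlap := (B.continuous_lap (α := α) he hv).continuousAt.eventually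
    (lt_mem_nhds hlapv)
  obtain ⟨ε, hε, p, ⟨-, -, hp1, hp2, hp3⟩, hp⟩ := exists_isLocalMax_add_mul hu.continuous hv.continuous
    (hmax.and (hpos.and (hsmall.and (hlap.and hor)))) (fun y hy => hy.1)
    (by simp [hvdef, hx]) (fun y hy huy hyx => by
      have h1 := hy.2.1 huy hyx
      have h2 := hy.2.2.1
      rw [lt_div_iff₀ hb0] at h2
      simp only [hvdef]
      nlinarith)
  have huv : ContMDiff 𝓘(ℝ, E) 𝓘(ℝ, ℝ) ∞ (fun y => u y + ε * v y) :=
    hu.add (contMDiff_const.mul hv)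
  have h1 := B.lap_nonpos_of_isLocalMax he hα huv hp
  rw [B.lap_add_const_mul he hu hv] at h1
  have h2 := hsub p e he hp3
  have h3 := mul_pos hε hp2
  linarith

end BiHermitianStructure

end MaximumPrinciple

section StrongMaximumPrinciple

variable {E : Type*} [NormedAddCommGroup E] [NormedSpace ℝ E] [FiniteDimensional ℝ E]
  {M : Type*} [TopologicalSpace M] [ChartedSpace E M] [IsManifold 𝓘(ℝ, E) ∞ M] [T2Space M]

/-- If a smooth function `u` is at most `u b` near `b` and not constant near `b`, then its level set
through `b` is touched, at some point near `b`, by a level set of a smooth function from one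
side. -/
theorem exists_touching {u : M → ℝ} (hu : Continuous u) {b : M} {U : Set M} (hU : IsOpen U)
    (hb : b ∈ U) (hnc : ∃ᶠ y in 𝓝 b, u y ≠ u b) :
    ∃ x ∈ U, u x = u b ∧ ∃ τ : M → ℝ, ContMDiff 𝓘(ℝ, E) 𝓘(ℝ, ℝ) ∞ τ ∧ τ x = 0 ∧
      mvfderiv 𝓘(ℝ, E) τ x ≠ 0 ∧ ∀ᶠ y in 𝓝 x, u y = u x → y ≠ x → 0 < τ y := by
  set T := toEuclidean (E := E)
  set ψ := (chartAt E b).transHomeomorph T.toHomeomorph with hψ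
  have hbs : b ∈ ψ.source := mem_chart_source E b
  have hO : IsOpen (ψ.target ∩ ψ.symm ⁻¹' U) := ψ.isOpen_inter_preimage_symm hU
  have hbO : ψ b ∈ ψ.target ∩ ψ.symm ⁻¹' U :=
    ⟨ψ.map_source hbs, by simpa [ψ.left_inv hbs] using hb⟩
  obtain ⟨r, hr, hball⟩ := Metric.nhds_basis_closedBall.mem_iff.1 (hO.mem_nhds hbO)
  obtain ⟨y, hy, hys, hyr⟩ := (hnc.and_eventually
    ((show ∀ᶠ y in 𝓝 b, y ∈ ψ.source from ψ.open_source.mem_nhds hbs).and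
    ((ψ.continuousAt hbs).eventually (Metric.ball_mem_nhds (ψ b) (half_pos hr))))).exists
  replace hyr : dist (ψ y) (ψ b) < r / 2 := hyr
  have hcont : ContinuousOn (fun z => u (ψ.symm z)) (Metric.closedBall (ψ b) r) :=
    hu.comp_continuousOn (ψ.symm.continuousOn.mono fun z hz => (hball hz).1)
  have hK : IsCompact (Metric.closedBall (ψ b) r ∩ (fun z => u (ψ.symm z)) ⁻¹' {u b}) :=
    (isCompact_closedBall _ _).of_isClosed_subset
      (hcont.preimage_isClosed_of_isClosed Metric.isClosed_closedBall isClosed_singleton)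
      Set.inter_subset_left
  have hbK : ψ b ∈ Metric.closedBall (ψ b) r ∩ (fun z => u (ψ.symm z)) ⁻¹' {u b} :=
    ⟨Metric.mem_closedBall_self hr.le, by simp [ψ.left_inv hbs]⟩
  obtain ⟨z, ⟨hzb, hzu⟩, hzmin⟩ := hK.exists_isMinOn ⟨_, hbK⟩
    (f := fun z => dist z (ψ y)) (by fun_prop)
  have hz1 : dist z (ψ y) ≤ dist (ψ b) (ψ y) := hzmin hbK
  have hz2 : dist z (ψ b) < r := by
    have := dist_triangle z (ψ y) (ψ b)
    rw [dist_comm (ψ b)] at hz1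
    linarith
  obtain ⟨hzt, hzU⟩ := hball hzb
  have hux : u (ψ.symm z) = u b := hzu
  have hzy : z ≠ ψ y := by
    rintro rfl
    rw [ψ.left_inv hys] at hux
    exact hy hux
  have hxs : ψ.symm z ∈ ψ.source := ψ.map_target hzt
  set Q : EuclideanSpace ℝ (Fin (Module.finrank ℝ E)) → ℝ :=
    fun w => ‖w - ψ y‖ ^ 2 + ‖w - z‖ ^ 2 - ‖z - ψ y‖ ^ 2 with hQ
  have hQs : ContDiff ℝ ∞ Q :=
    (((contDiff_id.sub contDiff_const).norm_sq ℝ).add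
      ((contDiff_id.sub contDiff_const).norm_sq ℝ)).sub contDiff_const
  have hψsm : ContMDiffOn 𝓘(ℝ, E) 𝓘(ℝ, EuclideanSpace ℝ (Fin (Module.finrank ℝ E))) ∞ ψ
      ψ.source :=
    T.contDiff.contMDiff.comp_contMDiffOn (contMDiffOn_chart (I := 𝓘(ℝ, E)) (n := ∞) (x := b))
  obtain ⟨τ, hτ, hτe⟩ := exists_contMDiff_eventuallyEq ψ.open_source hxs
    (hQs.contMDiff.comp_contMDiffOn hψsm)
  have hQz : Q z = 0 := by simp [hQ]
  refine ⟨ψ.symm z, hzU, hux, τ, hτ, ?_, ?_, ?_⟩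
  · rw [hτe.self_of_nhds]
    simp [ψ.right_inv hzt, hQz]
  · intro hd
    have h1 : HasMFDerivAt 𝓘(ℝ, E) 𝓘(ℝ, ℝ) τ (ψ.symm z) 0 := by
      have := (hτ.mdiffAt (ψ.symm z)).hasMFDerivAt
      have e : mfderiv 𝓘(ℝ, E) 𝓘(ℝ, ℝ) τ (ψ.symm z) = 0 := hd
      rwa [e] at this
    have hsymm : ContMDiffOn 𝓘(ℝ, EuclideanSpace ℝ (Fin (Module.finrank ℝ E))) 𝓘(ℝ, E) ∞
        ψ.symm ψ.target := by
      have h2 := contMDiffOn_chart_symm (I := 𝓘(ℝ, E)) (n := ∞) (x := b)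
      have h3 : ContMDiffOn 𝓘(ℝ, EuclideanSpace ℝ (Fin (Module.finrank ℝ E))) 𝓘(ℝ, E) ∞ T.symm
          ψ.target := T.symm.contDiff.contMDiff.contMDiffOn
      exact h2.comp h3 fun w hw => by simpa [hψ] using hw
    have h2 := ((hsymm.contMDiffAt (ψ.open_target.mem_nhds hzt)).mdifferentiableAt
      (by simp)).hasMFDerivAt
    have h3 := h1.comp z h2
    rw [ContinuousLinearMap.zero_comp] at h3
    have h4 : HasFDerivAt Q (0 : EuclideanSpace ℝ (Fin (Module.finrank ℝ E)) →L[ℝ] ℝ) z := by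
      refine HasFDerivAt.congr_of_eventuallyEq h3.hasFDerivAt ?_
      · have h5 : Tendsto ψ.symm (𝓝 z) (𝓝 (ψ.symm z)) := ψ.symm.continuousAt hzt
        filter_upwards [h5.eventually hτe, ψ.open_target.mem_nhds hzt] with w hw hwt
        simp [hw, ψ.right_inv hwt]
    have h5 := ((((hasFDerivAt_id z).sub_const (ψ y)).norm_sq).add
      (((hasFDerivAt_id z).sub_const z).norm_sq)).sub_const (‖z - ψ y‖ ^ 2)
    have h6 := congrArg (fun L => L (z - ψ y)) (h4.unique h5)
    simp at h6
    rw [← inner_sub_left, inner_self_eq_zero] at h6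
    exact hzy (sub_eq_zero.1 h6)
  · have h1 : ∀ᶠ w in 𝓝 (ψ.symm z), dist (ψ w) (ψ b) < r := by
      have := (ψ.continuousAt hxs)
      rw [ContinuousAt, ψ.right_inv hzt] at this
      exact this.eventually (Metric.isOpen_ball.mem_nhds hz2)
    filter_upwards [hτe, ψ.open_source.mem_nhds hxs, h1] with w hw hws hwr huw hne
    have hwK : ψ w ∈ Metric.closedBall (ψ b) r ∩ (fun z => u (ψ.symm z)) ⁻¹' {u b} :=
      ⟨hwr.le, by simp [ψ.left_inv hws, huw, hux]⟩
    have h2 : dist z (ψ y) ≤ dist (ψ w) (ψ y) := hzmin hwK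
    rw [dist_eq_norm, dist_eq_norm] at h2
    have h3 : 0 < ‖ψ w - z‖ := by
      rw [norm_pos_iff, sub_ne_zero]
      rintro rfl
      exact hne (ψ.left_inv hws).symm
    rw [hw]
    simp only [Function.comp_apply, hQ]
    have := pow_le_pow_left₀ (norm_nonneg _) h2 2
    have := pow_pos h3 2
    linarith

namespace BiHermitianStructure

variable (B : BiHermitianStructure E M) {α : ℝ}

/-- The strong maximum principle: on a compact manifold, a subsolution is locally constant. -/
theorem eventually_eq_of_subsolution [CompactSpace M] (hα : α ∈ Set.Icc (0 : ℝ) 1) {u : M → ℝ}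
    (hu : ContMDiff 𝓘(ℝ, E) 𝓘(ℝ, ℝ) ∞ u)
    (hsub : ∀ (x : M) (e : Fin (Module.finrank ℝ E) → ∀ x : M, TangentSpace 𝓘(ℝ, E) x),
      (∀ j, IsSmoothVF (e j)) →
      (∀ i j, B.g.inner x (e i x) (e j x) = if i = j then 1 else 0) → 0 ≤ B.lap α e u x) (x : M) :
    ∀ᶠ y in 𝓝 x, u y = u x := by
  have : LocallyConnectedSpace M := ChartedSpace.locallyConnectedSpace E M
  have hCo : IsOpen (connectedComponent x) := isOpen_connectedComponent
  have hCc : IsClosed (connectedComponent x) := isClosed_connectedComponent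
  obtain ⟨m, hmC, hm⟩ := hCc.isCompact.exists_isMaxOn ⟨x, mem_connectedComponent⟩
    hu.continuous.continuousOn
  have hloc : ∀ b ∈ connectedComponent x, u b = u m → ∀ᶠ y in 𝓝 b, u y = u b := by
    intro b hbC hbm
    by_contra hnc
    obtain ⟨p, hpC, hpb, τ, hτ, hτp, hdτ, hpos⟩ :=
      exists_touching (E := E) hu.continuous hCo hbC (not_eventually.1 hnc)
    have hmax : IsLocalMax u p := by
      filter_upwards [hCo.mem_nhds hpC] with y hy
      rw [hpb, hbm]
      exact hm hy
    exact B.not_touching hα hu hsub hmax hτ hτp hdτ hpos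
  have hopen : IsOpen (connectedComponent x ∩ {y | u y = u m}) := by
    rw [isOpen_iff_mem_nhds]
    rintro b ⟨hbC, hbm⟩
    filter_upwards [hCo.mem_nhds hbC, hloc b hbC hbm] with y hyC hy
    exact ⟨hyC, hy.trans hbm⟩
  have hclosed : IsClosed (connectedComponent x ∩ {y | u y = u m}) :=
    hCc.inter (isClosed_eq hu.continuous continuous_const)
  have hsubset := isPreconnected_connectedComponent.subset_isClopen ⟨hclosed, hopen⟩
    ⟨m, hmC, hmC, rfl⟩
  exact hloc x mem_connectedComponent (hsubset mem_connectedComponent).2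

end BiHermitianStructure

end StrongMaximumPrinciple

section Bochner

variable {E : Type*} [NormedAddCommGroup E] [NormedSpace ℝ E]
  {M : Type*} [TopologicalSpace M] [ChartedSpace E M] [IsManifold 𝓘(ℝ, E) ∞ M]
  {F : Type*} [NormedAddCommGroup F] [NormedSpace ℂ F]
  {V : M → Type*} [TopologicalSpace (TotalSpace F V)]
  [∀ x, AddCommGroup (V x)] [∀ x, Module ℂ (V x)] [∀ x, TopologicalSpace (V x)]
  [∀ x, IsTopologicalAddGroup (V x)] [∀ x, ContinuousSMul ℝ (V x)]
  [FiberBundle F V] [VectorBundle ℝ F V] [ContMDiffVectorBundle ∞ F V 𝓘(ℝ, E)]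

theorem contMDiff_re {f : M → ℂ} (hf : ContMDiff 𝓘(ℝ, E) 𝓘(ℝ, ℂ) ∞ f) :
    ContMDiff 𝓘(ℝ, E) 𝓘(ℝ, ℝ) ∞ (fun x => (f x).re) :=
  Complex.reCLM.contDiff.contMDiff.comp hf

theorem contMDiff_const_mul (c : ℂ) {f : M → ℂ} (hf : ContMDiff 𝓘(ℝ, E) 𝓘(ℝ, ℂ) ∞ f) :
    ContMDiff 𝓘(ℝ, E) 𝓘(ℝ, ℂ) ∞ (fun x => c * f x) :=
  ((c • ContinuousLinearMap.id ℂ ℂ).restrictScalars ℝ).contDiff.contMDiff.comp hf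

theorem contMDiff_ofReal {f : M → ℝ} (hf : ContMDiff 𝓘(ℝ, E) 𝓘(ℝ, ℝ) ∞ f) :
    ContMDiff 𝓘(ℝ, E) 𝓘(ℝ, ℂ) ∞ (fun x => (f x : ℂ)) :=
  Complex.ofRealCLM.contDiff.contMDiff.comp hf

namespace HermitianMetric

variable (h : HermitianMetric (E := E) F V)

theorem contMDiff_inner {σ τ : ∀ x, V x} (hσ : IsSmoothSection E F σ)
    (hτ : IsSmoothSection E F τ) :
    ContMDiff 𝓘(ℝ, E) 𝓘(ℝ, ℂ) ∞ (fun x => h.inner x (σ x) (τ x)) := by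
  have : ContMDiff 𝓘(ℝ, E) (𝓘(ℝ, E).prod 𝓘(ℝ, ℂ)) ∞
      (fun x => TotalSpace.mk' ℂ (E := Bundle.Trivial M ℂ) x (h.inner x (σ x) (τ x))) :=
    ContMDiff.clm_bundle_apply₂ (F₁ := F) (F₂ := F) (b := fun y : M => y) h.contMDiff hσ hτ
  intro x
  have := this x
  simp only [contMDiffAt_totalSpace] at this
  exact this.2

/-- The real inner product `Re h` on a fibre. -/
def reForm (x : M) : V x →ₗ[ℝ] V x →ₗ[ℝ] ℝ :=
  LinearMap.mk₂ ℝ (fun v w => (h.inner x v w).re)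
    (fun v v' w => by simp) (fun c v w => by simp) (fun v w w' => by simp) (fun c v w => by simp)

theorem inner_self_eq_re (x : M) (v : V x) : h.inner x v v = ((h.inner x v v).re : ℂ) :=
  (Complex.conj_eq_iff_re.1 (h.conj_symm x v v).symm).symm

theorem re_inner_self_nonneg (x : M) (v : V x) : 0 ≤ (h.inner x v v).re := by
  by_cases hv : v = 0
  · simp [hv]
  · exact (h.pos x v hv).le

theorem eq_zero_of_re_inner_self {x : M} {v : V x} (hv : (h.inner x v v).re ≤ 0) : v = 0 := by
  by_contra hne
  exact absurd (h.pos x v hne) (not_lt.2 hv)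

theorem diffAt_of_inner [FiniteDimensional ℝ E] [T2Space M] [FiniteDimensional ℂ F]
    {σ : ∀ x, V x} {x : M}
    (hσ : ∀ τ : ∀ x, V x, IsSmoothSection E F τ →
      MDifferentiableAt 𝓘(ℝ, E) 𝓘(ℝ, ℝ) (fun y => (h.inner y (σ y) (τ y)).re) x) :
    DiffAt E F σ x := by
  have : FiniteDimensional ℝ F := FiniteDimensional.complexToReal F
  exact mdifferentiableAt_section_of_inner (E := E) h.reForm
    (fun σ τ hσ hτ => contMDiff_re (h.contMDiff_inner hσ hτ))
    (fun x v w => by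
      change (h.inner x v w).re = (h.inner x w v).re
      rw [h.conj_symm x v w, Complex.conj_re])
    h.pos hσ

end HermitianMetric

theorem IsSmoothSection.diffAt {σ : ∀ x, V x} (hσ : IsSmoothSection E F σ) (x : M) :
    DiffAt E F σ x :=
  (hσ x).mdifferentiableAt (by simp)

variable {J : ComplexStructure E M} (D : HolomorphicStructure F V J)
  (h : HermitianMetric (E := E) F V)

theorem contMDiff_del {f : M → ℂ} (hf : ContMDiff 𝓘(ℝ, E) 𝓘(ℝ, ℂ) ∞ f)
    {X : ∀ x : M, TangentSpace 𝓘(ℝ, E) x} (hX : IsSmoothVF X) :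
    ContMDiff 𝓘(ℝ, E) 𝓘(ℝ, ℂ) ∞ (fun x => del J f x (X x)) := by
  have h1 := hX.contMDiff_mvfderiv hf
  have h2 := (J.isSmoothVF hX).contMDiff_mvfderiv hf
  exact contMDiff_const_mul _ (h1.sub (contMDiff_const_mul _ h2))

theorem HolomorphicStructure.isSmoothSection {σ : ∀ x, V x} (hσ : IsSmoothSection E F σ)
    {X : ∀ x : M, TangentSpace 𝓘(ℝ, E) x} (hX : IsSmoothVF X) :
    IsSmoothSection E F (fun x => D.toFun σ x (X x)) :=
  (D.smooth σ hσ).clm_bundle_apply (b := fun x => x) hX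

variable [FiniteDimensional ℂ F] [FiniteDimensional ℝ E]

theorem diffAt_chernDel [T2Space M] {σ : ∀ x, V x} (hσ : IsSmoothSection E F σ)
    {X : ∀ x : M, TangentSpace 𝓘(ℝ, E) x} (hX : IsSmoothVF X) (x : M) :
    DiffAt E F (fun y => chernDel D h σ y (X y)) x := by
  refine h.diffAt_of_inner fun τ hτ => ?_
  simp only [re_inner_chernDel D h (hσ.diffAt _) (hτ.diffAt _)]
  refine (contMDiff_re ?_).mdiffAt x
  exact (contMDiff_del (J := J) (h.contMDiff_inner hσ hτ) hX).sub
    (h.contMDiff_inner hσ (D.isSmoothSection hτ hX))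

theorem chernConnection_of_holomorphic {s : ∀ x, V x} {x : M} (hs : D.toFun s x = 0) :
    chernConnection D h s x = chernDel D h s x := by
  change chernDel D h s x + D.toFun s x = _
  rw [hs, add_zero]

variable [VectorBundle ℂ F V]

/-- The Bochner formula for a holomorphic section. -/
theorem re_inner_curvature [T2Space M] {s : ∀ x, V x} (hs : IsSmoothSection E F s)
    (hDs : ∀ x, D.toFun s x = 0) {X : ∀ x : M, TangentSpace 𝓘(ℝ, E) x} (hX : IsSmoothVF X) (x : M) :
    (h.inner x ((Complex.I / 2) •
        curvature (chernConnection D h) X (fun y => J.J y (X y)) s x) (s x)).re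
      = (h.inner x (chernConnection D h s x (X x)) (chernConnection D h s x (X x))).re
        - 1 / 4 * J.ddc X (fun y => (h.inner y (s y) (s y)).re) x := by
  have hJX := J.isSmoothVF hX
  set u : M → ℝ := fun y => (h.inner y (s y) (s y)).re with hu_def
  have hu : ContMDiff 𝓘(ℝ, E) 𝓘(ℝ, ℝ) ∞ u := contMDiff_re (h.contMDiff_inner hs hs)
  have hus : (fun y => h.inner y (s y) (s y)) = fun y => (u y : ℂ) :=
    funext fun y => h.inner_self_eq_re y (s y)
  have hc := fun y => chernConnection_of_holomorphic D h (hDs y)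
  set p : M → ℝ := fun y => mvfderiv 𝓘(ℝ, E) u y (X y) with hp_def
  set q : M → ℝ := fun y => mvfderiv 𝓘(ℝ, E) u y (J.J y (X y)) with hq_def
  have hp : ContMDiff 𝓘(ℝ, E) 𝓘(ℝ, ℝ) ∞ p := hX.contMDiff_mvfderiv hu
  have hq : ContMDiff 𝓘(ℝ, E) 𝓘(ℝ, ℝ) ∞ q := hJX.contMDiff_mvfderiv hu
  have hdel : ∀ (y : M) (v : TangentSpace 𝓘(ℝ, E) y),
      h.inner y (chernDel D h s y v) (s y) = 1 / 2 *
        ((mvfderiv 𝓘(ℝ, E) u y v : ℂ) - Complex.I * (mvfderiv 𝓘(ℝ, E) u y (J.J y v) : ℂ)) := by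
    intro y v
    have := del_inner D h (hs.diffAt y) (hs.diffAt y) v
    rw [hDs y, hus] at this
    simp only [zero_apply, map_zero, add_zero] at this
    rw [← this]
    simp only [del, smul_apply, sub_apply, ContinuousLinearMap.comp_apply,
      mvfderiv_ofReal (hu.mdiffAt y), smul_eq_mul]
  set θ : ∀ y, V y := fun y => chernDel D h s y (X y) with hθ_def
  have hθ : DiffAt E F θ x := diffAt_chernDel D h hs hX x
  have hθ' : DiffAt E F (fun y => Complex.I • θ y) x := diffAt_const_smul _ hθ
  set a : M → ℂ := fun y => 1 / 2 * (p y : ℂ) + (-Complex.I / 2) * (q y : ℂ) with ha_def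
  have ha : (fun y => h.inner y (θ y) (s y)) = a := by
    ext y
    rw [hθ_def, hdel, ha_def]
    ring
  have ha' : MDifferentiableAt 𝓘(ℝ, E) 𝓘(ℝ, ℂ) a x := ha ▸ h.mdifferentiableAt hθ (hs.diffAt x)
  have hda : ∀ v : TangentSpace 𝓘(ℝ, E) x, mvfderiv 𝓘(ℝ, E) a x v
      = 1 / 2 * (mvfderiv 𝓘(ℝ, E) p x v : ℂ)
        + (-Complex.I / 2) * (mvfderiv 𝓘(ℝ, E) q x v : ℂ) := by
    intro v
    have h1 := contMDiff_ofReal hp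
    have h2 := contMDiff_ofReal hq
    rw [ha_def, mvfderiv_fun_add ((contMDiff_const_mul (1 / 2) h1).mdiffAt x)
        ((contMDiff_const_mul (-Complex.I / 2) h2).mdiffAt x),
      add_apply, mvfderiv_const_mul _ (h1.mdiffAt x), mvfderiv_const_mul _ (h2.mdiffAt x), mvfderiv_ofReal (hp.mdiffAt x),
      mvfderiv_ofReal (hq.mdiffAt x)]
  have e1 : (fun y => chernConnection D h s y (X y)) = θ := by
    ext y
    rw [hc]
  have e2 : (fun y => chernConnection D h s y (J.J y (X y))) = fun y => Complex.I • θ y := by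
    ext y
    rw [hc, chernDel_J D h (hs.diffAt y)]
  have k1 := chernConnection_unitary D h hθ' (hs.diffAt x) (X x)
  have k2 := chernConnection_unitary D h hθ (hs.diffAt x) (J.J x (X x))
  have e3 : (fun y => h.inner y (Complex.I • θ y) (s y)) = fun y => Complex.I * a y := by
    ext y
    rw [h.smul_left, ← ha]
  rw [e3, mvfderiv_const_mul _ ha', hc, h.smul_left] at k1
  rw [ha, hc, chernDel_J D h (hs.diffAt x), h.smul_right, Complex.conj_I] at k2
  have k3 := hdel x (VectorField.mlieBracket 𝓘(ℝ, E) X (fun y => J.J y (X y)) x)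
  rw [h.smul_left, curvature, e1, e2, map_sub, map_sub, sub_apply, sub_apply, hc, k3]
  rw [hda] at k1 k2
  have hn := h.inner_self_eq_re x (θ x)
  simp only [hθ_def] at hn k1 k2
  rw [hn] at k1 k2
  rw [← sub_eq_iff_eq_add] at k1 k2
  simp only [hθ_def]
  rw [← k1, ← k2]
  simp only [ComplexStructure.ddc, Complex.mul_re, Complex.mul_im, Complex.add_re, Complex.add_im, Complex.sub_re, Complex.sub_im,
    Complex.ofReal_re, Complex.ofReal_im, Complex.I_re, Complex.I_im, Complex.neg_re, Complex.neg_im]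
  simp
  ring

end Bochner

section Vanishing

variable {E : Type*} [NormedAddCommGroup E] [NormedSpace ℝ E] [FiniteDimensional ℝ E]
  {M : Type*} [TopologicalSpace M] [ChartedSpace E M] [IsManifold 𝓘(ℝ, E) ∞ M] [T2Space M]
  {F : Type*} [NormedAddCommGroup F] [NormedSpace ℂ F] [FiniteDimensional ℂ F]
  {V : M → Type*} [TopologicalSpace (TotalSpace F V)]
  [∀ x, AddCommGroup (V x)] [∀ x, Module ℂ (V x)] [∀ x, TopologicalSpace (V x)]
  [∀ x, IsTopologicalAddGroup (V x)] [∀ x, ContinuousSMul ℝ (V x)]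
  [FiberBundle F V] [VectorBundle ℂ F V] [VectorBundle ℝ F V]
  [ContMDiffVectorBundle ∞ F V 𝓘(ℝ, E)]

theorem re_inner_meanCurvature {J : ComplexStructure E M} (D : HolomorphicStructure F V J)
    (h : HermitianMetric (E := E) F V) {s : ∀ x, V x} (hs : IsSmoothSection E F s)
    (hDs : ∀ x, D.toFun s x = 0)
    {e : Fin (Module.finrank ℝ E) → ∀ x : M, TangentSpace 𝓘(ℝ, E) x}
    (he : ∀ j, IsSmoothVF (e j)) (x : M) :
    (h.inner x (meanCurvature J (chernConnection D h) e s x) (s x)).re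
      = ∑ j, ((h.inner x (chernConnection D h s x (e j x)) (chernConnection D h s x (e j x))).re
        - 1 / 4 * J.ddc (e j) (fun y => (h.inner y (s y) (s y)).re) x) := by
  simp only [meanCurvature, Finset.smul_sum, map_sum, sum_apply, Complex.re_sum]
  exact Finset.sum_congr rfl fun j _ => re_inner_curvature D h hs hDs (he j) x

variable {B : BiHermitianStructure E M}
  {Dp : HolomorphicStructure F V B.Ip} {Dm : HolomorphicStructure F V B.Im}
  {h : HermitianMetric (E := E) F V} {α lam : ℝ}

/-- The Bochner formula for an `I_±`-holomorphic section and an `α`-Hermitian-Einstein metric. -/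
theorem IsHermitianEinstein.bochner (hHE : IsHermitianEinstein B Dp Dm h α lam)
    {s : ∀ x, V x} (hs : IsHolomorphicSection B Dp Dm s) (x : M)
    (e : Fin (Module.finrank ℝ E) → ∀ x : M, TangentSpace 𝓘(ℝ, E) x) (he : ∀ j, IsSmoothVF (e j))
    (hor : ∀ i j, B.g.inner x (e i x) (e j x) = if i = j then 1 else 0) :
    lam * (h.inner x (s x) (s x)).re
        + 1 / 4 * B.lap α e (fun y => (h.inner y (s y) (s y)).re) x
      = ∑ j, (α * (h.inner x (chernConnection Dp h s x (e j x))
            (chernConnection Dp h s x (e j x))).re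
          + (1 - α) * (h.inner x (chernConnection Dm h s x (e j x))
            (chernConnection Dm h s x (e j x))).re) := by
  have h1 := congrArg (fun v => (h.inner x v (s x)).re) (hHE x e s he hor hs.1)
  simp only [map_add, add_apply, h.smul_left, Complex.add_re, Complex.re_ofReal_mul,
    re_inner_meanCurvature Dp h hs.1 hs.2.1 he, re_inner_meanCurvature Dm h hs.1 hs.2.2 he] at h1
  rw [← h1, BiHermitianStructure.lap]
  simp only [Finset.mul_sum, ← Finset.sum_add_distrib]
  exact Finset.sum_congr rfl fun j _ => by ring

theorem IsHermitianEinstein.bochner_nonneg (hHE : IsHermitianEinstein B Dp Dm h α lam)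
    (hα : α ∈ Set.Icc (0 : ℝ) 1) {s : ∀ x, V x} (hs : IsHolomorphicSection B Dp Dm s) (x : M)
    (e : Fin (Module.finrank ℝ E) → ∀ x : M, TangentSpace 𝓘(ℝ, E) x) (he : ∀ j, IsSmoothVF (e j))
    (hor : ∀ i j, B.g.inner x (e i x) (e j x) = if i = j then 1 else 0) :
    0 ≤ lam * (h.inner x (s x) (s x)).re
        + 1 / 4 * B.lap α e (fun y => (h.inner y (s y) (s y)).re) x := by
  rw [hHE.bochner hs x e he hor]
  exact Finset.sum_nonneg fun j _ => add_nonneg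
    (mul_nonneg hα.1 (h.re_inner_self_nonneg _ _))
    (mul_nonneg (sub_nonneg.2 hα.2) (h.re_inner_self_nonneg _ _))

variable [CompactSpace M]

theorem IsHermitianEinstein.eq_zero_of_neg (hHE : IsHermitianEinstein B Dp Dm h α lam)
    (hα : α ∈ Set.Icc (0 : ℝ) 1) (hlam : lam < 0) {s : ∀ x, V x}
    (hs : IsHolomorphicSection B Dp Dm s) (x : M) : s x = 0 := by
  have : CompleteSpace E := FiniteDimensional.complete ℝ E
  have hu := contMDiff_re (h.contMDiff_inner hs.1 hs.1)
  obtain ⟨p, -, hp⟩ := isCompact_univ.exists_isMaxOn ⟨x, Set.mem_univ x⟩ hu.continuous.continuousOn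
  obtain ⟨e, he, hor⟩ := exists_orthonormal_fields B.g p
  have h1 := hHE.bochner_nonneg hα hs p e he hor.self_of_nhds
  have h2 := B.lap_nonpos_of_isLocalMax he hα hu (hp.isLocalMax Filter.univ_mem)
  have h3 : (h.inner x (s x) (s x)).re ≤ (h.inner p (s p) (s p)).re := hp (Set.mem_univ x)
  refine h.eq_zero_of_re_inner_self (h3.trans ?_)
  by_contra! h4
  linarith [mul_neg_of_neg_of_pos hlam h4]

theorem IsHermitianEinstein.parallel_of_zero (hHE : IsHermitianEinstein B Dp Dm h α 0)
    (hα : α ∈ Set.Ioo (0 : ℝ) 1) {s : ∀ x, V x} (hs : IsHolomorphicSection B Dp Dm s) (x : M) :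
    chernConnection Dp h s x = 0 ∧ chernConnection Dm h s x = 0 := by
  have : CompleteSpace E := FiniteDimensional.complete ℝ E
  have hα' := Set.Ioo_subset_Icc_self hα
  have hu := contMDiff_re (h.contMDiff_inner hs.1 hs.1)
  have hconst := B.eventually_eq_of_subsolution hα' hu (fun y e he hor => by
    have := hHE.bochner_nonneg hα' hs y e he hor
    linarith) x
  obtain ⟨e, he, hor⟩ := exists_orthonormal_fields B.g x
  have h1 := hHE.bochner hs x e he hor.self_of_nhds
  have h2 := B.lap_nonpos_of_isLocalMax he hα' hu (hconst.mono fun _ h => h.le)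
  have hp := fun j => h.re_inner_self_nonneg x (chernConnection Dp h s x (e j x))
  have hm := fun j => h.re_inner_self_nonneg x (chernConnection Dm h s x (e j x))
  have hα1 : 0 < 1 - α := sub_pos.2 hα.2
  have hnonneg := fun j => add_nonneg (mul_nonneg hα.1.le (hp j)) (mul_nonneg hα1.le (hm j))
  have h3 := (Finset.sum_eq_zero_iff_of_nonneg fun j _ => hnonneg j).1
    (le_antisymm (by rw [← h1]; linarith) (Finset.sum_nonneg fun j _ => hnonneg j))
  have key : ∀ L : TangentSpace 𝓘(ℝ, E) x →L[ℝ] V x,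
      (∀ j, (h.inner x (L (e j x)) (L (e j x))).re ≤ 0) → L = 0 := by
    intro L hL
    have := eq_zero_of_orthonormal B.g (fun j => e j x) hor.self_of_nhds L.toLinearMap
      fun j => h.eq_zero_of_re_inner_self (hL j)
    ext v
    exact LinearMap.congr_fun this v
  refine ⟨key _ fun j => ?_, key _ fun j => ?_⟩
  · by_contra! h4
    have := h3 j (Finset.mem_univ j)
    linarith [mul_pos hα.1 h4, mul_nonneg hα1.le (hm j)]
  · by_contra! h4
    have := h3 j (Finset.mem_univ j)
    linarith [mul_pos hα1 h4, mul_nonneg hα.1.le (hp j)]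

end Vanishing

end BiHerm

end

theorem theorem5p4
    {E : Type*} [NormedAddCommGroup E] [NormedSpace ℝ E] [FiniteDimensional ℝ E]
    {M : Type*} [TopologicalSpace M] [ChartedSpace E M] [IsManifold 𝓘(ℝ, E) ∞ M]
    [CompactSpace M] [T2Space M]
    {F : Type*} [NormedAddCommGroup F] [NormedSpace ℂ F] [FiniteDimensional ℂ F]
    {V : M → Type*} [TopologicalSpace (TotalSpace F V)]
    [∀ x, AddCommGroup (V x)] [∀ x, Module ℂ (V x)] [∀ x, TopologicalSpace (V x)]
    [∀ x, IsTopologicalAddGroup (V x)] [∀ x, ContinuousSMul ℝ (V x)]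
    [FiberBundle F V] [VectorBundle ℂ F V] [VectorBundle ℝ F V]
    [ContMDiffVectorBundle ∞ F V 𝓘(ℝ, E)]
    (B : BiHerm.BiHermitianStructure E M)
    (Dp : BiHerm.HolomorphicStructure F V B.Ip) (Dm : BiHerm.HolomorphicStructure F V B.Im)
    (h : BiHerm.HermitianMetric (E := E) F V)
    (α lam : ℝ) (hα : α ∈ Set.Icc (0 : ℝ) 1)
    (hHE : BiHerm.IsHermitianEinstein B Dp Dm h α lam) :
    (lam < 0 →
      ∀ s : (∀ x, V x), BiHerm.IsHolomorphicSection B Dp Dm s → ∀ x, s x = 0) ∧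
    (lam = 0 → α ∈ Set.Ioo (0 : ℝ) 1 →
      ∀ s : (∀ x, V x), BiHerm.IsHolomorphicSection B Dp Dm s →
        ∀ x, BiHerm.chernConnection Dp h s x = 0 ∧ BiHerm.chernConnection Dm h s x = 0) := by
  refine ⟨fun hlam s hs x => hHE.eq_zero_of_neg hα hlam hs x, fun hlam hα' s hs x => ?_⟩
  subst hlam
  exact hHE.parallel_of_zero hα' hs x
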